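/- **Setting (Civ:V).** The map is an infinite hexagonal grid; there is one player and no limit on the number of turns. Each tile carries No Improvement, a Road or a Railroad. The player has two Workers, and in each turn each Worker waits, moves to an adjacent traversable tile not occupied by a Worker, or works on its tile. Roads and Railroads may be built on any tile and take $B_r\ge 1$ and $B_{rr}\ge 1$ turns of work; a Road can be built only on a tile with No Improvement, a Railroad only on a tile without a Railroad (possibly on a Road) and only if the player has the Engineering technology; removing a Road or Railroad takes one turn. Assume that the player has Engineering, that the map contains a two-way infinite strip of pairwise distinct, consecutively adjacent, traversable tiles (the tape), and that, disjoint from the strip, there is a connected traversable section of the map owned by the player with nine reserved tiles. **The machine.** Let $Q=\{0,\dots,9\}$ and $\Gamma=\{\text{No Improvement},\text{Road},\text{Railroad}\}$, abbreviated $0,1,b$, with blank symbol $0$ and start state $0$, and let $\delta$ be given by the following table. An entry $s\,D\,q'$ means: write $s$, move $D$, go to state $q'$. | state | read $0$ | read $1$ | read $b$ | |---|---|---|---| | 0 | $1\,R\,0$ | $0\,L\,1$ | $b\,R\,3$ | | 1 | $0\,L\,2$ | $0\,L\,1$ | $b\,L\,1$ | | 2 | $0\,L\,1$ | $b\,L\,5$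 | $b\,R\,0$ | | 3 | $1\,R\,0$ | $1\,R\,4$ | $1\,L\,3$ | | 4 | $b\,L\,2$ | $1\,R\,4$ | $b\,R\,4$ | | 5 | $1\,L\,6$ | $1\,L\,5$ | $b\,L\,5$ | | 6 | $0\,R\,7$ | halt | $b\,L\,8$ | | 7 | $1\,L\,5$ | $1\,R\,7$ | $b\,R\,7$ | | 8 | $1\,L\,9$ | $0\,R\,9$ | $0\,L\,3$ | | 9 | $0\,R\,4$ | $0\,R\,9$ | $b\,R\,8$ | As commands to the Workers, an entry $s\,D\,q'$ in state $q$ reads: the tape Worker leaves, builds or removes an improvement so that its tile carries $s$, then moves one tile along the strip in direction $D$; the state Worker builds $q'-q$ Railroads on the reserved tiles (removes $q-q'$ if this is negative). **Theorem 2.** (a) This is a $(10,3)$-UTM: it has $10$ states and $3$ symbols, and there are primitive recursive encoding and decoding functions such that, for every Turing machine $M$ and every input word $w$, the machine, started in state $0$ on the finite initial tape (with head position) that encodes $M$ and $w$, halts if and only if $M$ halts on $w$, and then the final state and tape of $M$ are decoded from its final tape and $M$. Under $0,1,b$, its program corresponds one-to-one to that of Rogozhin's $(10,3)$-UTM. (b)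 The game carries this machine with constant overhead. Say that a game position represents a configuration if the number of Railroads on the nine reserved tiles is the state, the improvements on the strip as seen from the tape Worker are the tape as seen from the head, the state Worker is on a reserved tile, and no work is unfinished. Every configuration is represented by some position. In a position that represents a configuration $C$, the table commands to halt if and only if the machine halts in $C$; otherwise the player can carry out the command in at most $4\max(B_r,B_{rr})+1+K$ turns, where $K$ depends only on the map, the strip, the section and the reserved tiles, and whenever the command has been carried out, with nothing else changed on the map, the position represents the successor of $C$. -/

import Mathlib

/-! ## Turing machines and universality -/

/-- A (deterministic, one-tape) Turing machine with states `Q` and tape symbols `Γ`. The blank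
symbol is `default : Γ`. A transition gives the next state, the symbol written and the move of the
head. The set of symbols allowed in inputs is not recorded: below, an input may be any finite word
over `Γ`. -/
structure TuringMachine (Q Γ : Type) [Inhabited Γ] where
  start : Q
  final : Set Q
  δ : Q → Γ → Option (Q × Γ × Turing.Dir)
  δ_final : ∀ q ∈ final, ∀ s, δ q s = none

namespace TuringMachine

/-- A configuration: the state and the two-way infinite tape as seen from the head. -/
structure Config (Q Γ : Type) [Inhabited Γ] where
  state : Q
  tape : Turing.Tape Γ

variable {Q Γ : Type} [Inhabited Γ]

/-- One step: write, then move. It is `none` exactly when the machine halts. -/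
def step (M : TuringMachine Q Γ) (C : Config Q Γ) : Option (Config Q Γ) :=
  (M.δ C.state C.tape.head).map fun a => ⟨a.1, (C.tape.write a.2.1).move a.2.2⟩

/-- The halting configuration reached from `C`, if there is one. -/
def run (M : TuringMachine Q Γ) (C : Config Q Γ) : Part (Config Q Γ) :=
  StateTransition.eval M.step C

/-- The start configuration with `l` to the left of the head (nearest cell first), and `r` from the
head on to the right. All other cells are blank. -/
def init (M : TuringMachine Q Γ) (l r : List Γ) : Config Q Γ :=
  ⟨M.start, Turing.Tape.mk₂ l r⟩

/-- Finite descriptions of Turing machines: number of states, number of symbols, start state, and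
the list of all instructions (state, read, write, move, next state), a move to the right being
`true`. -/
abbrev Description : Type := ℕ × ℕ × ℕ × List (ℕ × ℕ × ℕ × Bool × ℕ)

/-- Whether a move goes to the right. -/
def isRight : Turing.Dir → Bool
  | .left => false
  | .right => true

/-- The description of a machine with states `0, …, n` and symbols `0, …, k`. -/
def description {n k : ℕ} (M : TuringMachine (Fin (n + 1)) (Fin (k + 1))) : Description :=
  (n + 1, k + 1, M.start.val,
    (List.finRange (n + 1)).flatMap fun q => (List.finRange (k + 1)).filterMap fun s =>
      (M.δ q s).map fun a => (q.val, s.val, a.2.1.val, isRight a.2.2, a.1.val))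

/-- `U` is universal: it simulates every Turing machine `M` on every input word `w`, from a suitable
finite initial tape that depends on (the description of) `M` and on `w`. That is, `U` halts on this
tape if and only if `M` halts on `w`, and then the final configuration of `M` (state and tape) can
be read off from the final tape of `U`. The encoding and the decoding are uniform in `M` and
primitive recursive, so neither of them can do the work of `U`.

Every Turing machine is, up to names of states and symbols, one with states `0, …, n`, symbols
`0, …, k` and blank symbol `0`. -/
def IsUniversal [Primcodable Γ] (U : TuringMachine Q Γ) : Prop :=
  ∃ (enc : Description × List ℕ → List Γ × List Γ)
    (dec : Description × List Γ × List Γ → ℕ × List ℕ × List ℕ),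
    Primrec enc ∧ Primrec dec ∧
    ∀ (n k : ℕ) (M : TuringMachine (Fin (n + 1)) (Fin (k + 1))) (w : List (Fin (k + 1))),
      let code := enc (M.description, w.map Fin.val)
      ((U.run (U.init code.1 code.2)).Dom ↔ (M.run (M.init [] w)).Dom) ∧
      ∀ D ∈ M.run (M.init [] w), ∀ E ∈ U.run (U.init code.1 code.2),
        ∀ l r : List Γ, E.tape = Turing.Tape.mk₂ l r →
          ∃ l' r' : List (Fin (k + 1)), D.tape = Turing.Tape.mk₂ l' r' ∧
            dec (M.description, l, r) = (D.state.val, l'.map Fin.val, r'.map Fin.val)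

end TuringMachine

/-! ## The game -/

namespace CivV

/-- What the route layer of a tile may carry. -/
inductive Improvement
  | noImprovement
  | road
  | railroad
  deriving DecidableEq

instance : Inhabited Improvement := ⟨.noImprovement⟩

/-- The numbering of the three improvements. -/
def Improvement.equivFin : Improvement ≃ Fin 3 where
  toFun
    | .noImprovement => 0
    | .road => 1
    | .railroad => 2
  invFun
    | 0 => .noImprovement
    | 1 => .road
    | 2 => .railroad
  left_inv := by intro s; cases s <;> rfl
  right_inv := by intro i; fin_cases i <;> rfl

instance : Fintype Improvement := Fintype.ofEquiv (Fin 3) Improvement.equivFin.symm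

instance : Primcodable Improvement := Primcodable.ofEquiv (Fin 3) Improvement.equivFin

/-- The hexagonal tiles of a map that is infinite in all directions, in axial coordinates. -/
abbrev Tile : Type := ℤ × ℤ

/-- Two tiles share an edge. -/
def hexGraph : SimpleGraph Tile where
  Adj s t := t - s ∈ ({(1, 0), (-1, 0), (0, 1), (0, -1), (1, -1), (-1, 1)} : Set (ℤ × ℤ))
  symm := ⟨by
    intro s t h
    have e : s - t = -(t - s) := by abel
    simp only [Set.mem_insert_iff, Set.mem_singleton_iff] at h ⊢
    rw [e]
    rcases h with h | h | h | h | h | h <;> rw [h] <;> decide⟩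
  loopless := ⟨by
    intro s h
    simp [Prod.ext_iff] at h⟩

/-- The fixed data of the map: the tiles that Workers can enter, and those the player owns. -/
structure GameMap where
  traversable : Set Tile
  owned : Set Tile

/-- The fixed data of the single player's session: whether the Engineering technology is unlocked,
and the numbers of turns needed to build a Road and a Railroad. -/
structure Session where
  engineering : Prop
  roadTurns : ℕ
  railroadTurns : ℕ
  roadTurns_pos : 0 < roadTurns
  railroadTurns_pos : 0 < railroadTurns

/-- The two Workers. -/
inductive Worker
  | tape
  | state
  deriving DecidableEq

/-- A game position: the improvements on the map, the turns of work already invested in unfinished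
improvements, and the places of the Workers. -/
structure Position where
  improvement : Tile → Improvement
  progress : Tile → Improvement → ℕ
  worker : Worker → Tile

/-- What a Worker may be told to do in one turn. -/
inductive Order
  | wait
  | move (t : Tile)
  | build (i : Improvement)
  | remove

/-- The number of turns that it takes to build an improvement. -/
def Session.turns (S : Session) : Improvement → ℕ
  | .noImprovement => 0
  | .road => S.roadTurns
  | .railroad => S.railroadTurns

/-- The rules: a Worker moves to an adjacent traversable tile that no Worker occupies; Roads and
Railroads may be built anywhere, but a Road only on a tile without Road and Railroad, and a Railroad
only with Engineering and on a tile without Railroad; Roads and Railroads can be removed. -/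
def Legal (G : GameMap) (S : Session) (P : Position) (w : Worker) : Order → Prop
  | .wait => True
  | .move t => hexGraph.Adj (P.worker w) t ∧ t ∈ G.traversable ∧ ∀ v, P.worker v ≠ t
  | .build .noImprovement => False
  | .build .road => P.improvement (P.worker w) = .noImprovement
  | .build .railroad => S.engineering ∧ P.improvement (P.worker w) ≠ .railroad
  | .remove => P.improvement (P.worker w) ≠ .noImprovement

/-- The effect of one turn of a Worker. Building adds a turn of work, and finishes (replacing what
was there) once the required number of turns is reached; removing takes a single turn. -/
def act (S : Session) (P : Position) (w : Worker) : Order → Position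
  | .wait => P
  | .move t => { P with worker := Function.update P.worker w t }
  | .build i =>
    if P.progress (P.worker w) i + 1 < S.turns i then
      { P with
        progress := fun t j =>
          if t = P.worker w ∧ j = i then P.progress t j + 1 else P.progress t j }
    else
      { P with
        improvement := Function.update P.improvement (P.worker w) i
        progress := Function.update P.progress (P.worker w) 0 }
  | .remove =>
    { P with improvement := Function.update P.improvement (P.worker w) .noImprovement }

/-- A turn of the game: the player gives an order to each of the Workers. -/
def Turn (G : GameMap) (S : Session) (P P' : Position) : Prop :=
  ∃ o₁ o₂ : Order, Legal G S P .tape o₁ ∧ Legal G S (act S P .tape o₁) .state o₂ ∧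
    P' = act S (act S P .tape o₁) .state o₂

/-- `Play G S n P P'`: the player can get from `P` to `P'` in exactly `n` turns. -/
inductive Play (G : GameMap) (S : Session) : ℕ → Position → Position → Prop
  | nil (P : Position) : Play G S 0 P P
  | cons {n : ℕ} {P P' P'' : Position} : Turn G S P P' → Play G S n P' P'' → Play G S (n + 1) P P''

/-! ## The machine -/

/-- What the tape Worker is told to do with the tile it stands on. -/
inductive TapeOrder
  | keep
  | buildRoad
  | buildRailroad
  | remove

/-- What the tile carries after the order, in terms of what it carried before. -/
def TapeOrder.result : TapeOrder → Improvement → Improvement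
  | .keep, s => s
  | .buildRoad, _ => .road
  | .buildRailroad, _ => .railroad
  | .remove, _ => .noImprovement

/-- A command to the Workers: what the tape Worker does with its tile, where it moves then, and how
many Railroads the state Worker builds (negative: removes) on the reserved tiles. -/
structure Command where
  tape : TapeOrder
  dir : Turing.Dir
  change : ℤ

/-- The commands, by the number of Railroads on the reserved tiles and the improvement under the
tape Worker; `none` is the command to halt. -/
def commandTable : Fin 10 → Improvement → Option Command
  | 0, .noImprovement => some ⟨.buildRoad, .right, 0⟩
  | 0, .road => some ⟨.remove, .left, 1⟩
  | 0, .railroad => some ⟨.keep, .right, 3⟩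
  | 1, .noImprovement => some ⟨.keep, .left, 1⟩
  | 1, .road => some ⟨.remove, .left, 0⟩
  | 1, .railroad => some ⟨.keep, .left, 0⟩
  | 2, .noImprovement => some ⟨.keep, .left, -1⟩
  | 2, .road => some ⟨.buildRailroad, .left, 3⟩
  | 2, .railroad => some ⟨.keep, .right, -2⟩
  | 3, .noImprovement => some ⟨.buildRoad, .right, -3⟩
  | 3, .road => some ⟨.keep, .right, 1⟩
  | 3, .railroad => some ⟨.buildRoad, .left, 0⟩
  | 4, .noImprovement => some ⟨.buildRailroad, .left, -2⟩
  | 4, .road => some ⟨.keep, .right, 0⟩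
  | 4, .railroad => some ⟨.keep, .right, 0⟩
  | 5, .noImprovement => some ⟨.buildRoad, .left, 1⟩
  | 5, .road => some ⟨.keep, .left, 0⟩
  | 5, .railroad => some ⟨.keep, .left, 0⟩
  | 6, .noImprovement => some ⟨.keep, .right, 1⟩
  | 6, .road => none
  | 6, .railroad => some ⟨.keep, .left, 2⟩
  | 7, .noImprovement => some ⟨.buildRoad, .left, -2⟩
  | 7, .road => some ⟨.keep, .right, 0⟩
  | 7, .railroad => some ⟨.keep, .right, 0⟩
  | 8, .noImprovement => some ⟨.buildRoad, .left, 1⟩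
  | 8, .road => some ⟨.remove, .right, 1⟩
  | 8, .railroad => some ⟨.remove, .left, -5⟩
  | 9, .noImprovement => some ⟨.keep, .right, -5⟩
  | 9, .road => some ⟨.remove, .right, 0⟩
  | 9, .railroad => some ⟨.keep, .right, -1⟩

/-- The Turing machine with states `0, …, 9` (numbers of Railroads), symbols No Improvement (the
blank), Road and Railroad, and the transition function given by the commands. -/
def machine : TuringMachine (Fin 10) Improvement where
  start := 0
  final := ∅
  δ q s := (commandTable q s).map fun c =>
    (Fin.ofNat 10 ((q.val : ℤ) + c.change).toNat, c.tape.result s, c.dir)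
  δ_final := by simp

/-- The symbols of Rogozhin's machine. -/
inductive RSymbol
  | zero
  | one
  | b
  deriving DecidableEq

instance : Inhabited RSymbol := ⟨.zero⟩

/-- Rogozhin's program with ten states and three symbols, numbered from `0`. -/
def rogozhinProgram : Fin 10 → RSymbol → Option (Fin 10 × RSymbol × Turing.Dir)
  | 0, .zero => some (0, .one, .right)
  | 0, .one => some (1, .zero, .left)
  | 0, .b => some (3, .b, .right)
  | 1, .zero => some (2, .zero, .left)
  | 1, .one => some (1, .zero, .left)
  | 1, .b => some (1, .b, .left)
  | 2, .zero => some (1, .zero, .left)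
  | 2, .one => some (5, .b, .left)
  | 2, .b => some (0, .b, .right)
  | 3, .zero => some (0, .one, .right)
  | 3, .one => some (4, .one, .right)
  | 3, .b => some (3, .one, .left)
  | 4, .zero => some (2, .b, .left)
  | 4, .one => some (4, .one, .right)
  | 4, .b => some (4, .b, .right)
  | 5, .zero => some (6, .one, .left)
  | 5, .one => some (5, .one, .left)
  | 5, .b => some (5, .b, .left)
  | 6, .zero => some (7, .zero, .right)
  | 6, .one => none
  | 6, .b => some (8, .b, .left)
  | 7, .zero => some (5, .one, .left)
  | 7, .one => some (7, .one, .right)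
  | 7, .b => some (7, .b, .right)
  | 8, .zero => some (9, .one, .left)
  | 8, .one => some (9, .zero, .right)
  | 8, .b => some (3, .zero, .left)
  | 9, .zero => some (4, .zero, .right)
  | 9, .one => some (9, .zero, .right)
  | 9, .b => some (8, .b, .right)

/-- The correspondence of symbols. -/
def toRogozhin : Improvement → RSymbol
  | .noImprovement => .zero
  | .road => .one
  | .railroad => .b

/-! ## The machine in the game -/

/-- The parts of the map that are used: a two-way infinite strip of traversable tiles (the tape),
and, disjoint from it, a connected traversable area owned by the player with nine reserved tiles. -/
structure Layout (G : GameMap) where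
  strip : ℤ → Tile
  strip_injective : Function.Injective strip
  strip_adj : ∀ i, hexGraph.Adj (strip i) (strip (i + 1))
  strip_traversable : ∀ i, strip i ∈ G.traversable
  area : Set Tile
  area_owned : area ⊆ G.owned
  area_traversable : area ⊆ G.traversable
  area_connected : (hexGraph.induce area).Connected
  strip_notMem_area : ∀ i, strip i ∉ area
  reserved : Finset Tile
  reserved_subset : (reserved : Set Tile) ⊆ area
  reserved_card : reserved.card = 9

namespace Layout

variable {G : GameMap} (L : Layout G)

/-- The number of Railroads on the reserved tiles. -/
def railroads (P : Position) : ℕ :=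
  (L.reserved.filter fun t => P.improvement t = .railroad).card

theorem railroads_lt (P : Position) : L.railroads P < 10 := by
  have h := Finset.card_filter_le L.reserved fun t => P.improvement t = .railroad
  rw [L.reserved_card] at h
  exact Nat.lt_succ_of_le h

/-- The command that the table gives in a position. -/
def command (P : Position) : Option Command :=
  commandTable ⟨L.railroads P, L.railroads_lt P⟩ (P.improvement (P.worker .tape))

/-- The number of steps to the right made by a move along the strip. -/
def offset : Turing.Dir → ℤ
  | .left => -1
  | .right => 1

/-- The position `P` shows the configuration `C`: the state is the number of Railroads on the
reserved tiles, the strip as seen from the tape Worker is the tape, the state Worker is on a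
reserved tile, and no work is unfinished. -/
def Represents (C : TuringMachine.Config (Fin 10) Improvement) (P : Position) : Prop :=
  L.railroads P = C.state.val ∧
  (∃ p : ℤ, P.worker .tape = L.strip p ∧
    ∀ i : ℤ, P.improvement (L.strip (p + i)) = C.tape.nth i) ∧
  P.worker .state ∈ L.reserved ∧
  P.progress = 0

/-- From `P` to `P'`, the command `c` has been carried out, and nothing else has changed on the
map (only which of the reserved tiles carry the Railroads is left to the player). -/
def CarriesOut (c : Command) (P P' : Position) : Prop :=
  (∃ p : ℤ, P.worker .tape = L.strip p ∧
    P'.worker .tape = L.strip (p + offset c.dir) ∧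
    P'.improvement (L.strip p) = c.tape.result (P.improvement (L.strip p)) ∧
    ∀ t, t ≠ L.strip p → t ∉ L.reserved → P'.improvement t = P.improvement t) ∧
  (L.railroads P' : ℤ) = L.railroads P + c.change ∧
  P'.worker .state ∈ L.reserved ∧
  P'.progress = 0

end Layout

end CivV

/-!
The machine simulates a tag system with deletion number two, as Rogozhin's machine does. Its
program, to the left of the head, is a series of runs of blanks, separated by Railroads, that lists
the productions in order; a letter is a unary code of Roads closed by Railroads. Each Road of the
first letter makes the machine cross one more segment of the program, whose blanks become Roads, so
that it stops at the production of this letter; the production is then copied to the end of the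
word, and the blanks of the program are restored. Tag systems simulate programs on two binary
stacks: a pop halves a number by reading its units in pairs, and the parity of the number survives
as a shift of the reading by one letter, which selects the next label. Two stacks are the two halves
of the tape of a Turing machine with two symbols, and such machines compute all partial recursive
functions, among them the one that runs a machine given by its description. The final number can be
recovered by counting the Railroads of the final tape.

In the game, a command needs at most one removal and one construction on the strip, a move, and on
the reserved tiles at most three constructions or five removals, with walks of bounded length
between them.
-/

/-! ## Simulations and runs -/

/-- The transition function `g` simulates `f` along `R`: a step of `f` is matched by at least one
step of `g`, and when `f` halts, `g` may go on for a while before it halts too, in a configuration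
related by `F` to the last one of `f`. -/
structure Simulates {σ τ : Type*} (f : σ → Option σ) (g : τ → Option τ) (R F : σ → τ → Prop) :
    Prop where
  step : ∀ {a c a'}, R a c → f a = some a' → ∃ c', R a' c' ∧ StateTransition.Reaches₁ g c c'
  halt : ∀ {a c}, R a c → f a = none → ∃ c', StateTransition.Reaches g c c' ∧ g c' = none ∧ F a c'

namespace Simulates

open StateTransition

variable {σ τ : Type*} {f : σ → Option σ} {g : τ → Option τ} {R F : σ → τ → Prop} {a : σ} {c : τ}

/-- The relation between configurations of `f` and `g` that are related by `R` while `f` is running,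
and are both final once `f` has halted. -/
def Settled (f : σ → Option σ) (g : τ → Option τ) (R F : σ → τ → Prop) (a : σ) (c : τ) : Prop :=
  (f a ≠ none → R a c) ∧ (f a = none → g c = none ∧ F a c)

theorem exists_settled (h : Simulates f g R F) (hR : R a c) :
    ∃ c', Settled f g R F a c' ∧ Reaches g c c' := by
  by_cases ha : f a = none
  · obtain ⟨c', hc, hg, hF⟩ := h.halt hR ha
    exact ⟨c', ⟨fun ha' => absurd ha ha', fun _ => ⟨hg, hF⟩⟩, hc⟩
  · exact ⟨c, ⟨fun _ => hR, fun ha' => absurd ha' ha⟩, .refl⟩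

-- Letting `g` run to its end as soon as `f` has halted turns the simulation into a refinement.
theorem respects_settled (h : Simulates f g R F) : Respects f g (Settled f g R F) := by
  intro a c hac
  cases ha : f a with
  | none => exact (hac.2 ha).1
  | some a' =>
    obtain ⟨c₁, hR, h₁⟩ := h.step (hac.1 (by simp [ha])) ha
    obtain ⟨c₂, hS, h₂⟩ := h.exists_settled hR
    exact ⟨c₂, hS, h₁.trans_left h₂⟩

theorem eval_dom_iff (h : Simulates f g R F) (hR : R a c) :
    (eval g c).Dom ↔ (eval f a).Dom := by
  obtain ⟨c', hS, hc⟩ := h.exists_settled hR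
  rw [reaches_eval hc, tr_eval_dom h.respects_settled hS]

theorem exists_mem_eval (h : Simulates f g R F) (hR : R a c) {b : σ} (hb : b ∈ eval f a) :
    ∃ d ∈ eval g c, F b d := by
  obtain ⟨c', hS, hc⟩ := h.exists_settled hR
  obtain ⟨d, hbd, hd⟩ := tr_eval h.respects_settled hS hb
  exact ⟨d, by rwa [reaches_eval hc], (hbd.2 (mem_eval.1 hb).2).2⟩

end Simulates

namespace TuringMachine

open Relation Turing

variable {Q Γ : Type} [Inhabited Γ]

/-- Reachability of configurations in any number of steps. -/
abbrev Reaches (M : TuringMachine Q Γ) : Config Q Γ → Config Q Γ → Prop :=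
  ReflTransGen fun C C' => C' ∈ M.step C

/-- Reachability of configurations in at least one step. -/
abbrev Reaches₁ (M : TuringMachine Q Γ) : Config Q Γ → Config Q Γ → Prop :=
  TransGen fun C C' => C' ∈ M.step C

namespace Config

/-- The configuration whose tape is `l` (nearest cell first) followed by `r`, with the head on the
last cell of the left half. -/
def onLeft (q : Q) (l r : List Γ) : Config Q Γ :=
  ⟨q, (Tape.mk₂ l r).move .left⟩

/-- The configuration whose tape is `l` (nearest cell first) followed by `r`, with the head on the
first cell of the right half. -/
def onRight (q : Q) (l r : List Γ) : Config Q Γ :=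
  ⟨q, Tape.mk₂ l r⟩

theorem onLeft_cons (q : Q) (l r : List Γ) (a : Γ) :
    onLeft q (a :: l) r = onRight q l (a :: r) := by
  simp [onLeft, onRight, Tape.mk₂]

theorem onRight_nil (q : Q) (l : List Γ) : onRight q l [] = onRight q l [default] := rfl

end Config

open Config

variable {M : TuringMachine Q Γ} {q q' : Q} {a b : Γ} {l r : List Γ} {C : Config Q Γ}

theorem step_onRight_of_right (h : M.δ q a = some (q', b, .right)) :
    M.step (onRight q l (a :: r)) = some (onRight q' (b :: l) r) := by
  simp [step, onRight, Tape.mk₂, Tape.mk', Tape.write, Tape.move, h]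

theorem step_onRight_of_left (h : M.δ q a = some (q', b, .left)) :
    M.step (onRight q l (a :: r)) = some (onLeft q' l (b :: r)) := by
  simp [step, onRight, onLeft, Tape.mk₂, Tape.mk', Tape.write, Tape.move, h]

namespace Reaches

@[simp] theorem refl : M.Reaches C C := ReflTransGen.refl

theorem trans {C' C'' : Config Q Γ} (h : M.Reaches C C') (h' : M.Reaches C' C'') :
    M.Reaches C C'' :=
  ReflTransGen.trans h h'

instance : Trans M.Reaches M.Reaches M.Reaches := ⟨trans⟩

theorem onRight_right (q' : Q) (b : Γ) (h : M.δ q a = some (q', b, .right))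
    (hC : M.Reaches (onRight q' (b :: l) r) C) : M.Reaches (onRight q l (a :: r)) C :=
  hC.head (step_onRight_of_right h)

theorem onRight_left (q' : Q) (b : Γ) (h : M.δ q a = some (q', b, .left))
    (hC : M.Reaches (onLeft q' l (b :: r)) C) : M.Reaches (onRight q l (a :: r)) C :=
  hC.head (step_onRight_of_left h)

theorem onLeft_right (q' : Q) (b : Γ) (h : M.δ q a = some (q', b, .right))
    (hC : M.Reaches (onRight q' (b :: l) r) C) : M.Reaches (onLeft q (a :: l) r) C := by
  rw [onLeft_cons]
  exact hC.onRight_right q' b h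

theorem onLeft_left (q' : Q) (b : Γ) (h : M.δ q a = some (q', b, .left))
    (hC : M.Reaches (onLeft q' l (b :: r)) C) : M.Reaches (onLeft q (a :: l) r) C := by
  rw [onLeft_cons]
  exact hC.onRight_left q' b h

theorem reaches₁ {C' : Config Q Γ} (h : M.Reaches C C') (hq : C.state ≠ C'.state) :
    M.Reaches₁ C C' :=
  (reflTransGen_iff_eq_or_transGen.1 h).resolve_left fun e => hq (congrArg Config.state e.symm)

end Reaches

theorem reaches_sweep_right (g : Γ → Γ) (s : List Γ)
    (h : ∀ a ∈ s, M.δ q a = some (q, g a, .right)) (l r : List Γ) :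
    M.Reaches (onRight q l (s ++ r)) (onRight q ((s.map g).reverse ++ l) r) := by
  induction s generalizing l with
  | nil => exact .refl
  | cons a s ih =>
    refine .onRight_right q (g a) (h a (by simp)) ?_
    simpa using ih (fun a ha => h a (by simp [ha])) (g a :: l)

theorem reaches_sweep_left (g : Γ → Γ) (s : List Γ)
    (h : ∀ a ∈ s, M.δ q a = some (q, g a, .left)) (l r : List Γ) :
    M.Reaches (onLeft q (s ++ l) r) (onLeft q l ((s.map g).reverse ++ r)) := by
  induction s generalizing r with
  | nil => exact .refl
  | cons a s ih =>
    refine .onLeft_left q (g a) (h a (by simp)) ?_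
    simpa using ih (fun a ha => h a (by simp [ha])) (g a :: r)

end TuringMachine

/-! ## Runs of the machine -/

namespace CivV

open TuringMachine TuringMachine.Config List

local notation "▢" => Improvement.noImprovement
local notation "◫" => Improvement.road
local notation "■" => Improvement.railroad
local notation:50 C " ⟶* " C':51 => TuringMachine.Reaches machine C C'

theorem replicate_append_cons_self {α : Type*} (k : ℕ) (a : α) (l : List α) :
    replicate k a ++ a :: l = a :: (replicate k a ++ l) := by
  rw [append_cons, ← replicate_succ', replicate_succ, cons_append]

/-- Runs of `k + 1` cells with the symbol `s`, for `k` in `ks`, each followed by a Railroad. A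
number of the tag system's program is held by such a run of blanks, and while the run is in use its
cells are Roads. -/
def runs (s : Improvement) (ks : List ℕ) : List Improvement :=
  ks.flatMap fun k => replicate (k + 1) s ++ [■]

@[simp] theorem runs_nil (s : Improvement) : runs s [] = [] := rfl

@[simp] theorem runs_cons (s : Improvement) (k : ℕ) (ks : List ℕ) :
    runs s (k :: ks) = replicate (k + 1) s ++ ■ :: runs s ks := by
  simp [runs]

@[simp] theorem runs_append (s : Improvement) (ks ks' : List ℕ) :
    runs s (ks ++ ks') = runs s ks ++ runs s ks' := by
  simp [runs]

theorem mem_runs {s a : Improvement} {ks : List ℕ} (h : a ∈ runs s ks) : a = s ∨ a = ■ := by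
  simp only [runs, mem_flatMap, mem_append, mem_replicate, mem_singleton] at h
  tauto

theorem noImprovement_notMem_runs_road (ks : List ℕ) : ▢ ∉ runs ◫ ks := fun h => by
  simpa using mem_runs h

theorem count_railroad_runs {s : Improvement} (hs : s ≠ ■) (ks : List ℕ) :
    (runs s ks).count ■ = ks.length := by
  induction ks with
  | nil => rfl
  | cons k ks ih => simp [count_replicate, ih, hs]

/-- The exchange of No Improvement and Road, which keeps Railroads: what the machine does to the
program while it passes over it. -/
def toggle : Improvement → Improvement
  | .noImprovement => ◫
  | .road => ▢
  | .railroad => ■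

theorem map_toggle_runs_road (ks : List ℕ) : (runs ◫ ks).map toggle = runs ▢ ks := by
  induction ks <;> simp_all [toggle]

theorem reaches_erase_left (c : ℕ) (ks : List ℕ) (l r : List Improvement) :
    onLeft 1 (replicate c ◫ ++ runs ◫ ks ++ l) r ⟶*
      onLeft 1 l ((replicate c ▢ ++ runs ▢ ks).reverse ++ r) := by
  have h := reaches_sweep_left (M := machine) (q := 1) toggle (replicate c ◫ ++ runs ◫ ks)
    (fun a ha => by
      rcases mem_append.1 ha with ha | ha
      · rw [(mem_replicate.1 ha).2]; rfl
      · rcases mem_runs ha with rfl | rfl <;> rfl) l r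
  simpa only [map_append, map_replicate, map_toggle_runs_road, toggle] using h

theorem reaches_fill (c : ℕ) (l r : List Improvement) :
    onRight 0 l (replicate c ▢ ++ r) ⟶* onRight 0 (replicate c ◫ ++ l) r := by
  have h := reaches_sweep_right (M := machine) (q := 0) toggle (replicate c ▢)
    (fun a ha => by rw [(mem_replicate.1 ha).2]; rfl) l r
  simpa only [map_replicate, reverse_replicate, toggle] using h

theorem reaches_fill_run (k : ℕ) (l r : List Improvement) :
    onRight 0 l (■ :: (replicate (k + 1) ▢ ++ r)) ⟶*
      onRight 0 (replicate (k + 1) ◫ ++ ■ :: l) r := by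
  rw [replicate_succ, cons_append]
  refine .onRight_right 3 ■ rfl (.onRight_right 0 ◫ rfl ?_)
  simpa [replicate_succ'] using reaches_fill k (◫ :: ■ :: l) r

theorem reaches_fill_runs (ks : List ℕ) (l r : List Improvement) :
    onRight 0 l ((runs ▢ ks).reverse ++ r) ⟶* onRight 0 (runs ◫ ks ++ l) r := by
  induction ks generalizing r with
  | nil => exact .refl
  | cons k ks ih =>
    simpa using (ih (■ :: (replicate (k + 1) ▢ ++ r))).trans (reaches_fill_run k _ r)

theorem reaches_fill_right (c : ℕ) (ks : List ℕ) (l r : List Improvement) :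
    onRight 0 l ((replicate c ▢ ++ runs ▢ ks).reverse ++ r) ⟶*
      onRight 0 (replicate c ◫ ++ runs ◫ ks ++ l) r := by
  simpa using (reaches_fill_runs ks l (replicate c ▢ ++ r)).trans
    (reaches_fill c (runs ◫ ks ++ l) r)

-- States 1 and 2 alternate on blanks, so the head leaves a run in state 1 if its length is even
-- and in state 2 if it is odd; only in the latter case does the Railroad turn it around.
theorem reaches_cross_even (j : ℕ) (l r : List Improvement) :
    onLeft 1 (replicate (2 * j) ▢ ++ l) r ⟶* onLeft 1 l (replicate (2 * j) ▢ ++ r) := by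
  induction j generalizing r with
  | zero => exact .refl
  | succ j ih =>
    rw [Nat.mul_succ, replicate_succ, replicate_succ, cons_append, cons_append]
    refine .onLeft_left 2 ▢ rfl (.onLeft_left 1 ▢ rfl ?_)
    simpa [replicate_append_cons_self] using ih (▢ :: ▢ :: r)

/-- The runs of the segment `(js, k)` of the program: runs of the even lengths `2 * (j + 1)` for `j`
in `js`, followed by a run of the odd length `2 * k + 1`, which ends the segment. -/
def segmentRuns (s : List ℕ × ℕ) : List ℕ :=
  s.1.map (fun j => 2 * j + 1) ++ [2 * s.2]

theorem reaches_pass_segment (s : List ℕ × ℕ) (l r : List Improvement) :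
    onLeft 1 (runs ▢ (segmentRuns s) ++ l) r ⟶* onRight 0 (runs ◫ (segmentRuns s) ++ l) r := by
  obtain ⟨js, k⟩ := s
  induction js generalizing r with
  | nil =>
    calc onLeft (1 : Fin 10) (runs ▢ (segmentRuns ([], k)) ++ l) r
      _ = onLeft 1 (replicate (2 * k) ▢ ++ ▢ :: ■ :: l) r := by simp [segmentRuns, replicate_succ']
      _ ⟶* onLeft 1 (▢ :: ■ :: l) (replicate (2 * k) ▢ ++ r) := reaches_cross_even k _ r
      _ ⟶* onRight 0 (■ :: l) (replicate (2 * k + 1) ▢ ++ r) :=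
        .onLeft_left 2 ▢ rfl (.onLeft_right 0 ■ rfl .refl)
      _ ⟶* onRight 0 (replicate (2 * k + 1) ◫ ++ ■ :: l) r := reaches_fill _ _ r
      _ = onRight 0 (runs ◫ (segmentRuns ([], k)) ++ l) r := by simp [segmentRuns]
  | cons j js ih =>
    calc onLeft (1 : Fin 10) (runs ▢ (segmentRuns (j :: js, k)) ++ l) r
      _ = onLeft 1 (replicate (2 * (j + 1)) ▢ ++ ■ :: (runs ▢ (segmentRuns (js, k)) ++ l)) r := by
        simp [segmentRuns, Nat.mul_succ]
      _ ⟶* onLeft 1 (■ :: (runs ▢ (segmentRuns (js, k)) ++ l)) (replicate (2 * (j + 1)) ▢ ++ r) :=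
        reaches_cross_even _ _ r
      _ ⟶* onLeft 1 (runs ▢ (segmentRuns (js, k)) ++ l) (■ :: (replicate (2 * (j + 1)) ▢ ++ r)) :=
        .onLeft_left 1 ■ rfl .refl
      _ ⟶* onRight 0 (runs ◫ (segmentRuns (js, k)) ++ l)
          (■ :: (replicate (2 * (j + 1)) ▢ ++ r)) := ih _
      _ ⟶* onRight 0 (replicate (2 * (j + 1)) ◫ ++ ■ :: (runs ◫ (segmentRuns (js, k)) ++ l)) r :=
        reaches_fill_run (2 * j + 1) _ r
      _ = onRight 0 (runs ◫ (segmentRuns (j :: js, k)) ++ l) r := by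
        simp [segmentRuns, Nat.mul_succ]

-- Every Road of the word that is erased moves the border between Roads and blanks in the program
-- on by one segment.
theorem reaches_pass_segments (S : List (List ℕ × ℕ)) (c : ℕ) (ks : List ℕ)
    (l r : List Improvement) :
    onRight 0 (replicate c ◫ ++ runs ◫ ks ++ runs ▢ (S.flatMap segmentRuns) ++ l)
        (replicate S.length ◫ ++ r) ⟶*
      onRight 0 (replicate (c + S.length) ◫ ++ runs ◫ (ks ++ S.flatMap segmentRuns) ++ l) r := by
  induction S generalizing c ks with
  | nil => simp
  | cons s S ih =>
    let l' := runs ▢ (S.flatMap segmentRuns) ++ l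
    let r' := replicate S.length ◫ ++ r
    calc onRight (0 : Fin 10)
          (replicate c ◫ ++ runs ◫ ks ++ runs ▢ ((s :: S).flatMap segmentRuns) ++ l)
          (replicate (s :: S).length ◫ ++ r)
      _ ⟶* onLeft 1 (replicate c ◫ ++ runs ◫ ks ++ (runs ▢ (segmentRuns s) ++ l')) (▢ :: r') :=
        .onRight_left 1 ▢ rfl (by simp [l', r'])
      _ ⟶* onLeft 1 (runs ▢ (segmentRuns s) ++ l')
          ((replicate c ▢ ++ runs ▢ ks).reverse ++ ▢ :: r') := reaches_erase_left c ks _ _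
      _ ⟶* onRight 0 (runs ◫ (segmentRuns s) ++ l')
          ((replicate c ▢ ++ runs ▢ ks).reverse ++ ▢ :: r') := reaches_pass_segment s _ _
      _ ⟶* onRight 0 (replicate c ◫ ++ runs ◫ ks ++ (runs ◫ (segmentRuns s) ++ l')) (▢ :: r') :=
        reaches_fill_right c ks _ _
      _ ⟶* onRight 0 (replicate (c + 1) ◫ ++ runs ◫ (ks ++ segmentRuns s) ++ l') r' :=
        .onRight_right 0 ◫ rfl (by simp [replicate_succ])
      _ ⟶* onRight 0 (replicate (c + (s :: S).length) ◫ ++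
          runs ◫ (ks ++ (s :: S).flatMap segmentRuns) ++ l) r := by
        simpa [l', r', Nat.add_assoc, Nat.add_comm 1] using ih (c + 1) (ks ++ segmentRuns s)

theorem reaches_search (S : List (List ℕ × ℕ)) (n : ℕ) (hS : S.length = n + 1)
    (l r : List Improvement) :
    onLeft 1 (runs ▢ (S.flatMap segmentRuns) ++ l) (▢ :: ▢ :: ▢ :: (replicate n ◫ ++ r)) ⟶*
      onRight 0 (replicate (n + 3) ◫ ++ runs ◫ (S.flatMap segmentRuns) ++ l) r := by
  obtain _ | ⟨s, S⟩ := S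
  · simp at hS
  obtain rfl : S.length = n := by simpa using hS
  let l' := runs ▢ (S.flatMap segmentRuns) ++ l
  let r' := replicate S.length ◫ ++ r
  calc onLeft (1 : Fin 10) (runs ▢ ((s :: S).flatMap segmentRuns) ++ l) (▢ :: ▢ :: ▢ :: r')
    _ = onLeft 1 (runs ▢ (segmentRuns s) ++ l') (replicate 3 ▢ ++ r') := by simp [l']
    _ ⟶* onRight 0 (runs ◫ (segmentRuns s) ++ l') (replicate 3 ▢ ++ r') :=
      reaches_pass_segment s _ _
    _ ⟶* onRight 0 (replicate 3 ◫ ++ (runs ◫ (segmentRuns s) ++ l')) r' := reaches_fill 3 _ _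
    _ ⟶* onRight 0 (replicate (S.length + 3) ◫ ++
        runs ◫ ((s :: S).flatMap segmentRuns) ++ l) r := by
      simpa [l', r', Nat.add_comm] using reaches_pass_segments S 3 (segmentRuns s) l r

theorem reaches_cross_left {F : List Improvement} (hF : ▢ ∉ F) (l r : List Improvement) :
    onLeft 5 (F.reverse ++ l) r ⟶* onLeft 5 l (F ++ r) := by
  have h (a : Improvement) (ha : a ∈ F.reverse) : machine.δ 5 a = some (5, a, .left) := by
    have : a ≠ ▢ := fun e => hF (by simpa [e] using ha)
    cases a <;> first | contradiction | rfl
  simpa using reaches_sweep_left id F.reverse h l r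

theorem reaches_cross_right {q : Fin 10} (h₁ : machine.δ q ◫ = some (q, ◫, .right))
    (h₂ : machine.δ q ■ = some (q, ■, .right)) {F : List Improvement} (hF : ▢ ∉ F)
    (l : List Improvement) : onRight q l F ⟶* onRight q (F.reverse ++ l) [▢] := by
  have h (a : Improvement) (ha : a ∈ F) : machine.δ q a = some (q, a, .right) := by
    have : a ≠ ▢ := fun e => hF (e ▸ ha)
    cases a <;> first | contradiction | assumption
  have h := reaches_sweep_right id F h l []
  rwa [append_nil, map_id, onRight_nil] at h

theorem reaches_close {F : List Improvement} (hF : ▢ ∉ F) (l : List Improvement) :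
    onRight 4 l (F ++ [◫]) ⟶* onLeft 5 l (F ++ [■, ■]) :=
  calc onRight (4 : Fin 10) l (F ++ [◫])
    _ ⟶* onRight 4 ((F ++ [◫]).reverse ++ l) [▢] :=
      reaches_cross_right rfl rfl (by simpa using hF) l
    _ ⟶* onLeft 5 (F.reverse ++ l) [■, ■] := by
      simpa using .onRight_left 2 ■ rfl (.onLeft_left 5 ■ rfl .refl)
    _ ⟶* onLeft 5 l (F ++ [■, ■]) := reaches_cross_left hF l _

theorem reaches_append_road {F : List Improvement} (hF : ▢ ∉ F) (l : List Improvement) :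
    onRight 7 l F ⟶* onLeft 5 l (F ++ [◫]) :=
  calc onRight (7 : Fin 10) l F
    _ ⟶* onRight 7 (F.reverse ++ l) [▢] := reaches_cross_right rfl rfl hF l
    _ ⟶* onLeft 5 (F.reverse ++ l) [◫] := .onRight_left 5 ◫ rfl .refl
    _ ⟶* onLeft 5 l (F ++ [◫]) := reaches_cross_left hF l _

theorem reaches_join {U F : List Improvement} (hU : ▢ ∉ U) (hF : ▢ ∉ F) (l : List Improvement) :
    onRight 0 (◫ :: (U ++ l)) (■ :: ■ :: (F ++ [◫])) ⟶*
      onLeft 5 l (U.reverse ++ ◫ :: ◫ :: ◫ :: (F ++ [■, ■])) :=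
  calc onRight (0 : Fin 10) (◫ :: (U ++ l)) (■ :: ■ :: (F ++ [◫]))
    _ ⟶* onRight 4 (◫ :: (U ++ l)) (◫ :: ◫ :: F ++ [◫]) :=
      .onRight_right 3 ■ rfl <| .onRight_left 3 ◫ rfl <| .onLeft_left 3 ◫ rfl <|
        .onLeft_right 4 ◫ rfl .refl
    _ ⟶* onLeft 5 (◫ :: (U ++ l)) (◫ :: ◫ :: F ++ [■, ■]) := reaches_close (by simpa using hF) _
    _ = onLeft 5 ((U.reverse ++ [◫]).reverse ++ l) (◫ :: ◫ :: F ++ [■, ■]) := by simp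
    _ ⟶* onLeft 5 l (U.reverse ++ [◫] ++ (◫ :: ◫ :: F ++ [■, ■])) :=
      reaches_cross_left (by simpa using hU) l _
    _ = onLeft 5 l (U.reverse ++ ◫ :: ◫ :: ◫ :: (F ++ [■, ■])) := by simp

theorem reaches_copy_run (k : ℕ) {F : List Improvement} (hF : ▢ ∉ F) (l : List Improvement) :
    onLeft 5 (replicate (k + 1) ▢ ++ l) F ⟶*
      onLeft 5 (▢ :: l) (replicate k ◫ ++ F ++ replicate k ◫) := by
  induction k generalizing F with
  | zero => simp
  | succ k ih =>
    calc onLeft (5 : Fin 10) (replicate (k + 2) ▢ ++ l) F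
      _ = onLeft 5 (▢ :: ▢ :: (replicate k ▢ ++ l)) F := by simp [replicate_succ]
      _ ⟶* onRight 7 (▢ :: (replicate k ▢ ++ l)) (◫ :: F) :=
        .onLeft_left 6 ◫ rfl <| .onLeft_right 7 ▢ rfl .refl
      _ ⟶* onLeft 5 (▢ :: (replicate k ▢ ++ l)) (◫ :: F ++ [◫]) :=
        reaches_append_road (by simpa using hF) _
      _ = onLeft 5 (replicate (k + 1) ▢ ++ l) (◫ :: F ++ [◫]) := by simp [replicate_succ]
      _ ⟶* onLeft 5 (▢ :: l) (replicate k ◫ ++ (◫ :: F ++ [◫]) ++ replicate k ◫) :=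
        ih (by simpa using hF)
      _ = onLeft 5 (▢ :: l) (replicate (k + 1) ◫ ++ F ++ replicate (k + 1) ◫) := by
        simp [replicate_succ, replicate_append_cons_self]

/-- The code of a letter: its number in unary, followed by two Railroads. -/
def letterCode (i : ℕ) : List Improvement :=
  replicate (2 * i + 1) ◫ ++ [■, ■]

/-- The code of a word. Its last letter is left open: a Road stands for the two Railroads. -/
def openCode : List ℕ → List Improvement
  | [] => []
  | [i] => replicate (2 * i + 2) ◫
  | i :: j :: w => letterCode i ++ openCode (j :: w)

theorem exists_openCode_eq (i : ℕ) (w : List ℕ) :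
    ∃ F, ▢ ∉ F ∧ openCode (i :: w) = F ++ [◫] ∧ (i :: w).flatMap letterCode = F ++ [■, ■] := by
  induction w generalizing i with
  | nil =>
    exact ⟨replicate (2 * i + 1) ◫, by simp, by simp [openCode, replicate_succ'],
      by simp [letterCode]⟩
  | cons j w ih =>
    obtain ⟨F, h₁, h₂, h₃⟩ := ih j
    exact ⟨letterCode i ++ F, by simpa [letterCode] using h₁, by rw [openCode, h₂, append_assoc],
      by rw [flatMap_cons, h₃, append_assoc]⟩

theorem openCode_append (w : List ℕ) (i : ℕ) (w' : List ℕ) :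
    openCode (w ++ i :: w') = w.flatMap letterCode ++ openCode (i :: w') := by
  induction w with
  | nil => rfl
  | cons j w ih =>
    rw [flatMap_cons, append_assoc, ← ih]
    cases w <;> rfl

theorem count_railroad_flatMap_letterCode (w : List ℕ) :
    (w.flatMap letterCode).count ■ = 2 * w.length := by
  simp [count_flatMap, Function.comp_def, letterCode, count_replicate, mul_comm]

/-- The runs of the production `i :: w` of a letter: the part of the program that the machine
copies. -/
def copyRuns (i : ℕ) (w : List ℕ) : List ℕ :=
  (2 * i + 2) :: w.map fun j => 2 * j + 3

theorem reaches_copy (i : ℕ) (w : List ℕ) {F : List Improvement} (hF : ▢ ∉ F)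
    (l : List Improvement) :
    onLeft 5 (runs ▢ (copyRuns i w) ++ ▢ :: ■ :: l) F ⟶*
      onRight 8 (■ :: l) (◫ :: ((runs ◫ (copyRuns i w)).reverse ++ F ++ openCode (i :: w))) := by
  induction w generalizing i F with
  | nil =>
    let F' := replicate (2 * i + 2) ◫ ++ F ++ replicate (2 * i + 2) ◫
    calc onLeft (5 : Fin 10) (runs ▢ (copyRuns i []) ++ ▢ :: ■ :: l) F
      _ = onLeft 5 (replicate (2 * i + 2 + 1) ▢ ++ ■ :: ▢ :: ■ :: l) F := by simp [copyRuns]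
      _ ⟶* onLeft 5 (▢ :: ■ :: ▢ :: ■ :: l) F' := reaches_copy_run (2 * i + 2) hF _
      _ ⟶* onRight 8 (■ :: l) (◫ :: ■ :: ◫ :: F') :=
        .onLeft_left 6 ◫ rfl <| .onLeft_left 8 ■ rfl <| .onLeft_left 9 ◫ rfl <|
          .onLeft_right 8 ■ rfl .refl
      _ = onRight 8 (■ :: l) (◫ :: ((runs ◫ (copyRuns i [])).reverse ++ F ++ openCode [i])) := by
        simp [F', copyRuns, openCode, replicate_succ, replicate_append_cons_self]
  | cons j w ih =>
    let l' := replicate (2 * j + 2) ▢ ++ ■ :: (runs ▢ (w.map fun j => 2 * j + 3) ++ ▢ :: ■ :: l)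
    let F' := ◫ :: ■ :: ◫ :: (replicate (2 * i + 2) ◫ ++ F ++ replicate (2 * i + 1) ◫)
    have hF' : ▢ ∉ F' := by simpa [F'] using hF
    calc onLeft (5 : Fin 10) (runs ▢ (copyRuns i (j :: w)) ++ ▢ :: ■ :: l) F
      _ = onLeft 5 (replicate (2 * i + 2 + 1) ▢ ++ ■ :: ▢ :: ▢ :: l') F := by
        simp [l', copyRuns, replicate_succ]
      _ ⟶* onLeft 5 (▢ :: ■ :: ▢ :: ▢ :: l')
          (replicate (2 * i + 2) ◫ ++ F ++ replicate (2 * i + 2) ◫) :=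
        reaches_copy_run (2 * i + 2) hF _
      _ ⟶* onRight 4 (▢ :: l')
          (◫ :: ■ :: ◫ :: (replicate (2 * i + 2) ◫ ++ F ++ replicate (2 * i + 2) ◫)) :=
        .onLeft_left 6 ◫ rfl <| .onLeft_left 8 ■ rfl <| .onLeft_left 9 ◫ rfl <|
          .onLeft_right 4 ▢ rfl .refl
      _ = onRight 4 (▢ :: l') (F' ++ [◫]) := by simp [F', replicate_succ']
      _ ⟶* onLeft 5 (▢ :: l') (F' ++ [■, ■]) := reaches_close hF' _
      _ = onLeft 5 (runs ▢ (copyRuns j w) ++ ▢ :: ■ :: l) (F' ++ [■, ■]) := by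
        simp [l', copyRuns, replicate_succ]
      _ ⟶* onRight 8 (■ :: l)
          (◫ :: ((runs ◫ (copyRuns j w)).reverse ++ (F' ++ [■, ■]) ++ openCode (j :: w))) :=
        ih j (by simpa using hF')
      _ = onRight 8 (■ :: l)
          (◫ :: ((runs ◫ (copyRuns i (j :: w))).reverse ++ F ++ openCode (i :: j :: w))) := by
        simp [F', copyRuns, openCode, letterCode, replicate_succ, replicate_append_cons_self]

theorem reaches_erase (c : ℕ) (l r : List Improvement) :
    onRight 9 l (replicate c ◫ ++ r) ⟶* onRight 9 (replicate c ▢ ++ l) r := by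
  have h := reaches_sweep_right (M := machine) (q := 9) toggle (replicate c ◫)
    (fun a ha => by rw [(mem_replicate.1 ha).2]; rfl) l r
  simpa only [map_replicate, reverse_replicate, toggle] using h

theorem reaches_erase_run (k : ℕ) (l r : List Improvement) :
    onRight 9 l (■ :: (replicate (k + 1) ◫ ++ r)) ⟶*
      onRight 9 (replicate (k + 1) ▢ ++ ■ :: l) r := by
  rw [replicate_succ, cons_append]
  refine .onRight_right 8 ■ rfl (.onRight_right 9 ▢ rfl ?_)
  simpa [replicate_succ'] using reaches_erase k (▢ :: ■ :: l) r

theorem reaches_erase_runs (ks : List ℕ) (l r : List Improvement) :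
    onRight 9 l ((runs ◫ ks).reverse ++ r) ⟶* onRight 9 (runs ▢ ks ++ l) r := by
  induction ks generalizing r with
  | nil => exact .refl
  | cons k ks ih =>
    simpa using (ih (■ :: (replicate (k + 1) ◫ ++ r))).trans (reaches_erase_run k _ r)

-- The first two letters of the word have become Roads. They are erased together with the Roads of
-- the program, except for the blanks that stay behind as the new end of the program.
theorem reaches_restore (c : ℕ) (ks : List ℕ) (l r : List Improvement) :
    onRight 8 (■ :: l) (◫ :: ((runs ◫ ks).reverse ++ (replicate (c + 1) ◫ ++ ■ :: ■ :: r))) ⟶*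
      onLeft 1 (replicate c ▢ ++ (runs ▢ ks ++ ▢ :: ■ :: l)) (▢ :: ▢ :: ▢ :: r) :=
  let r' := replicate (c + 1) ◫ ++ ■ :: ■ :: r
  let l' := runs ▢ ks ++ ▢ :: ■ :: l
  calc onRight (8 : Fin 10) (■ :: l) (◫ :: ((runs ◫ ks).reverse ++ r'))
    _ ⟶* onRight 9 (▢ :: ■ :: l) ((runs ◫ ks).reverse ++ r') := .onRight_right 9 ▢ rfl .refl
    _ ⟶* onRight 9 l' r' := reaches_erase_runs ks _ _
    _ ⟶* onRight 9 (replicate (c + 1) ▢ ++ l') (■ :: ■ :: r) := reaches_erase _ _ _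
    _ = onRight 9 (▢ :: (replicate c ▢ ++ l')) (■ :: ■ :: r) := by rw [replicate_succ, cons_append]
    _ ⟶* onLeft 1 (replicate c ▢ ++ l') (▢ :: ▢ :: ▢ :: r) :=
      .onRight_right 8 ■ rfl <| .onRight_left 3 ▢ rfl <| .onLeft_left 3 ◫ rfl <|
        .onLeft_right 0 ◫ rfl <| .onRight_left 1 ▢ rfl <| .onLeft_left 1 ▢ rfl .refl

/-- The segments of the production of a letter. -/
def productionSegments : List ℕ → List (List ℕ × ℕ)
  | [] => []
  | i :: w => [([], i + 1), (w.map (· + 1), 0)]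

theorem flatMap_productionSegments (i : ℕ) (w : List ℕ) :
    (productionSegments (i :: w)).flatMap segmentRuns = copyRuns i w ++ [0] := by
  simp [productionSegments, segmentRuns, copyRuns, Function.comp_def, Nat.mul_add]

theorem length_flatMap_productionSegments {ps : List (List ℕ)} (h : ∀ w ∈ ps, w ≠ []) :
    (ps.flatMap productionSegments).length = 2 * ps.length := by
  induction ps with
  | nil => rfl
  | cons w ps ih =>
    obtain ⟨hw, hps⟩ := forall_mem_cons.1 h
    obtain ⟨i, w, rfl⟩ := exists_cons_of_ne_nil hw
    simp [productionSegments, ih hps, Nat.mul_succ, ← Nat.add_assoc, Nat.add_comm]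

/-- The segments of the program of a tag system. The first two lead to the first production; the
first one collects what remains of the letters that have been read, so its length `E` varies. -/
def programSegments (ps : List (List ℕ)) (E : ℕ) : List (List ℕ × ℕ) :=
  ([], E) :: ([], 0) :: ps.flatMap productionSegments

/-- The runs of the program of the tag system with productions `ps`. -/
def programRuns (ps : List (List ℕ)) (E : ℕ) : List ℕ :=
  (programSegments ps E).flatMap segmentRuns

/-- The configuration of the machine for a word `w` in the tag system with productions `ps`. -/
def tagConfig (ps : List (List ℕ)) (E : ℕ) (w : List ℕ) : Config (Fin 10) Improvement :=
  onLeft 1 (runs ▢ (programRuns ps E) ++ [▢, ◫]) (▢ :: ▢ :: ▢ :: openCode w)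

theorem length_programRuns (ps : List (List ℕ)) (E : ℕ) :
    (programRuns ps E).length = (programRuns ps 0).length := by
  simp [programRuns, programSegments, segmentRuns]

theorem programRuns_append_cons (ps : List (List ℕ)) (E i : ℕ) (v : List ℕ) (qs : List (List ℕ)) :
    programRuns (ps ++ (i :: v) :: qs) E =
      programRuns ps E ++ copyRuns i v ++ 0 :: (qs.flatMap productionSegments).flatMap segmentRuns
        := by
  simp only [programRuns, programSegments, flatMap_append, flatMap_cons,
    flatMap_productionSegments, append_assoc, cons_append, nil_append]

theorem runs_programRuns_add (ps : List (List ℕ)) (E n : ℕ) :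
    runs ▢ (programRuns ps (n + E)) = replicate (2 * n) ▢ ++ runs ▢ (programRuns ps E) := by
  simp [programRuns, programSegments, segmentRuns, Nat.mul_add, Nat.add_assoc, replicate_add]

-- The unary code of the first letter makes the machine pass over the program up to the production
-- of this letter.
theorem reaches_find {ps : List (List ℕ)} (hps : ∀ w ∈ ps, w ≠ []) (E j : ℕ) (w : List ℕ)
    (l : List Improvement) :
    onLeft 1 (runs ▢ (programRuns ps E) ++ l)
        (▢ :: ▢ :: ▢ :: openCode (ps.length :: j :: w)) ⟶*
      onLeft 5 l ((runs ◫ (programRuns ps E)).reverse ++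
        (replicate (2 * ps.length + 6) ◫ ++ (j :: w).flatMap letterCode)) := by
  obtain ⟨F, hF, h₁, h₂⟩ := exists_openCode_eq j w
  rw [openCode, letterCode, h₁, h₂, append_assoc]
  have hU : ▢ ∉ replicate (2 * ps.length + 3) ◫ ++ runs ◫ (programRuns ps E) := by
    simp [noImprovement_notMem_runs_road]
  have hlen : (programSegments ps E).length = 2 * ps.length + 1 + 1 := by
    simp [programSegments, length_flatMap_productionSegments hps]
  refine (reaches_search _ _ hlen _ _).trans ?_
  simpa [programRuns, replicate_succ, replicate_append_cons_self] using reaches_join hU hF l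

theorem reaches_tagConfig (ps : List (List ℕ)) (i : ℕ) (v : List ℕ) (qs : List (List ℕ))
    (hps : ∀ w ∈ ps, w ≠ []) (E j : ℕ) (w : List ℕ) :
    machine.Reaches₁ (tagConfig (ps ++ (i :: v) :: qs) E (ps.length :: j :: w))
      (tagConfig (ps ++ (i :: v) :: qs) (ps.length + j + 3 + E) (w ++ i :: v)) := by
  let l := runs ▢ ((qs.flatMap productionSegments).flatMap segmentRuns) ++ [▢, ◫]
  let F := (runs ◫ (programRuns ps E)).reverse ++
    (replicate (2 * ps.length + 6) ◫ ++ (j :: w).flatMap letterCode)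
  have hF : ▢ ∉ F := by
    simp [F, noImprovement_notMem_runs_road, letterCode]
  have hfind : tagConfig (ps ++ (i :: v) :: qs) E (ps.length :: j :: w) ⟶*
      onLeft 5 (runs ▢ (copyRuns i v) ++ ▢ :: ■ :: l) F := by
    simpa [tagConfig, programRuns_append_cons, l, F] using
      reaches_find hps E j w (runs ▢ (copyRuns i v) ++ ▢ :: ■ :: l)
  refine .trans_left (hfind.reaches₁ (by simp [tagConfig, onLeft])) ?_
  have hadd : 2 * (ps.length + j + 3) + 1 = 2 * ps.length + 6 + (2 * j + 1) := by ring
  calc onLeft (5 : Fin 10) (runs ▢ (copyRuns i v) ++ ▢ :: ■ :: l) F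
    _ ⟶* onRight 8 (■ :: l) (◫ :: ((runs ◫ (copyRuns i v)).reverse ++ F ++ openCode (i :: v))) :=
      reaches_copy i v hF l
    _ = onRight 8 (■ :: l) (◫ :: ((runs ◫ (programRuns ps E ++ copyRuns i v)).reverse ++
        (replicate (2 * (ps.length + j + 3) + 1) ◫ ++ ■ :: ■ :: openCode (w ++ i :: v)))) := by
      simp [F, hadd, openCode_append, letterCode, replicate_add]
    _ ⟶* onLeft 1 (replicate (2 * (ps.length + j + 3)) ▢ ++ (runs ▢ (programRuns ps E ++
        copyRuns i v) ++ ▢ :: ■ :: l)) (▢ :: ▢ :: ▢ :: openCode (w ++ i :: v)) :=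
      reaches_restore _ _ _ _
    _ = tagConfig (ps ++ (i :: v) :: qs) (ps.length + j + 3 + E) (w ++ i :: v) := by
      simp [tagConfig, runs_programRuns_add _ E, programRuns_append_cons, l]

-- The letter after the last production makes the machine run into the end of the program.
theorem reaches_halt {ps : List (List ℕ)} (hps : ∀ w ∈ ps, w ≠ []) (E j : ℕ) (w : List ℕ) :
    ∃ F, tagConfig ps E (ps.length :: j :: w) ⟶* onLeft 6 [◫] F ∧
      F.count ■ = (programRuns ps 0).length + 2 * (w.length + 1) := by
  refine ⟨_, (reaches_find hps E j w [▢, ◫]).trans (.onLeft_left 6 ◫ rfl .refl), ?_⟩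
  simp only [count_cons, count_append, count_reverse, count_railroad_flatMap_letterCode]
  simp [count_railroad_runs, count_replicate, length_programRuns ps E]

end CivV

/-! ## Tag systems and programs on two stacks -/

/-- A tag system (with deletion number two): the word to be appended for each letter, and the letter
on which the system halts. -/
structure TagSystem (α : Type*) where
  production : α → List α
  halt : α

namespace TagSystem

open Relation

variable {α : Type*}

/-- One step of a tag system: the first two letters of the word are removed, and the production of
the first one is appended. -/
inductive Step (T : TagSystem α) : List α → List α → Prop
  | intro {a : α} (ha : a ≠ T.halt) (b : α) (w : List α) :
    T.Step (a :: b :: w) (w ++ T.production a)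

/-- Reachability of words in any number of steps. -/
abbrev Reaches (T : TagSystem α) : List α → List α → Prop := ReflTransGen T.Step

/-- Reachability of words in at least one step. -/
abbrev Reaches₁ (T : TagSystem α) : List α → List α → Prop := TransGen T.Step

/-- The concatenation of `n` copies of the word `w`. -/
def repeatWord (n : ℕ) (w : List α) : List α := (List.replicate n w).flatten

@[simp] theorem repeatWord_zero (w : List α) : repeatWord 0 w = [] := rfl

theorem repeatWord_succ (n : ℕ) (w : List α) : repeatWord (n + 1) w = w ++ repeatWord n w := rfl

theorem repeatWord_two_mul (n : ℕ) (w : List α) : repeatWord (2 * n) w = repeatWord n (w ++ w) := by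
  induction n with
  | zero => rfl
  | succ n ih => simp [Nat.mul_succ, repeatWord_succ, ih]

@[simp] theorem length_repeatWord (n : ℕ) (w : List α) :
    (repeatWord n w).length = n * w.length := by
  simp [repeatWord]

@[simp] theorem map_repeatWord {β : Type*} (f : α → β) (n : ℕ) (w : List α) :
    (repeatWord n w).map f = repeatWord n (w.map f) := by
  simp [repeatWord]

variable {T : TagSystem α}

theorem reaches_repeatWord {a : α} (ha : a ≠ T.halt) (b : α) (n : ℕ) (w : List α) :
    T.Reaches (repeatWord n [a, b] ++ w) (w ++ repeatWord n (T.production a)) := by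
  induction n generalizing w with
  | zero => simpa using ReflTransGen.refl
  | succ n ih =>
    rw [repeatWord_succ, List.append_assoc]
    refine .head (.intro ha b _) ?_
    simpa [repeatWord_succ] using ih (w ++ T.production a)

theorem reaches₁_cons_repeatWord {a c : α} (ha : a ≠ T.halt) (hc : c ≠ T.halt) (b d : α) (n : ℕ)
    (w : List α) :
    T.Reaches₁ (a :: b :: (repeatWord n [c, d] ++ w))
      (w ++ T.production a ++ repeatWord n (T.production c)) := by
  refine .head' (.intro ha b _) ?_
  simpa using reaches_repeatWord hc d n (w ++ T.production a)

-- A missing second letter shifts the reading by one: now the second letter of each pair counts, and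
-- the shift is passed on to the rest of the word.
theorem reaches₁_shift {a d : α} (ha : a ≠ T.halt) (hd : d ≠ T.halt) (c e : α) (n : ℕ)
    (w : List α) :
    T.Reaches₁ (a :: (repeatWord n [c, d] ++ e :: w))
      (w ++ T.production a ++ repeatWord n (T.production d)) := by
  induction n generalizing a w with
  | zero => simpa using TransGen.single (Step.intro ha e w)
  | succ n ih =>
    rw [repeatWord_succ, List.append_assoc]
    refine .head (.intro ha c _) ?_
    simpa [repeatWord_succ] using ih hd (w ++ T.production a)

/-- The word for two numbers `u` and `v`: the letters `A` and `B` mark the beginnings of the numbers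
and the letters `a` and `b` are their units. Every second letter is `x`. -/
def pairWord (x A a B b : α) (u v : ℕ) : List α :=
  A :: x :: (repeatWord u [a, x] ++ B :: x :: repeatWord v [b, x])

theorem reaches₁_pairWord_rotate {x A a B b A' a' : α} (hA : T.production A = [A', x])
    (ha : T.production a = [a', x]) (hAh : A ≠ T.halt) (hah : a ≠ T.halt) (u v : ℕ) :
    T.Reaches₁ (pairWord x A a B b u v) (pairWord x B b A' a' v u) := by
  simpa [hA, ha, pairWord] using
    reaches₁_cons_repeatWord hAh hah x x u (B :: x :: repeatWord v [b, x])

theorem reaches₁_pairWord {x A a B b : α} (hA : A ≠ T.halt) (ha : a ≠ T.halt) (hB : B ≠ T.halt)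
    (hb : b ≠ T.halt) (u v : ℕ) :
    T.Reaches₁ (pairWord x A a B b u v)
      (T.production A ++ repeatWord u (T.production a) ++
        (T.production B ++ repeatWord v (T.production b))) := by
  refine (reaches₁_cons_repeatWord hA ha x x u (B :: x :: repeatWord v [b, x])).trans ?_
  simpa using reaches₁_cons_repeatWord hB hb x x v (T.production A ++ repeatWord u (T.production a))

end TagSystem

/-- The instructions of a program that works on two binary stacks, which are given as numbers. A
move pushes a bit to one stack, pops a bit from the other one and branches on it. -/
inductive StackInstruction (Λ : Type)
  | right (a : Bool) (next : Bool → Λ)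
  | left (a : Bool) (next : Bool → Λ)
  | goto (ℓ : Λ)
  | halt (a : Bool)

/-- One step of a program on two stacks. -/
def stackStep {Λ : Type} (P : Λ → StackInstruction Λ) (c : Λ × ℕ × ℕ) : Option (Λ × ℕ × ℕ) :=
  match P c.1 with
  | .right a next => some (next c.2.2.bodd, Nat.bit a c.2.1, c.2.2.div2)
  | .left a next => some (next c.2.1.bodd, c.2.1.div2, Nat.bit a c.2.2)
  | .goto ℓ => some (ℓ, c.2.1, c.2.2)
  | .halt _ => none

/-- The letters of the tag system of a program on two stacks. In `num`, `aux`, `mid` and `out`, the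
first Boolean tells the second number from the first one, and the second Boolean tells the letter
that marks the beginning of a number from the unit. -/
inductive TagLetter (Λ : Type)
  | filler
  | halt
  | num (side big : Bool) (ℓ : Λ)
  | aux (side big : Bool) (ℓ : Λ)
  | mid (side big : Bool) (ℓ : Λ)
  | out (side big bit : Bool) (ℓ : Λ)
  deriving DecidableEq, Fintype

namespace TagLetter

open TagSystem

variable {Λ : Type}

/-- The letters that double a number and push the bit `a` to it. -/
def push (a : Bool) (ℓ : Λ) : Bool → List (TagLetter Λ)
  | true => mid false true ℓ :: filler :: bif a then [mid false false ℓ, filler] else []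
  | false => [mid false false ℓ, filler, mid false false ℓ, filler]

/-- The productions of the letters for numbers, by the instruction at the label `ℓ`. -/
def numProduction (ℓ : Λ) : StackInstruction Λ → Bool → Bool → List (TagLetter Λ)
  | .right a _, false, big => push a ℓ big
  | .right _ _, true, big => [mid true big ℓ]
  | .left _ _, false, big => [aux false big ℓ, filler]
  | .left a _, true, big => push a ℓ big
  | .goto ℓ', side, big => [num side big ℓ', filler]
  | .halt a, false, true => halt :: filler :: bif a then [filler, filler] else []
  | .halt _, true, true => [filler, filler]
  | .halt _, _, false => [filler, filler, filler, filler]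

/-- The letter that is produced at the end of an instruction, by the bit that has been popped. -/
def target : StackInstruction Λ → Bool → Bool → Bool → TagLetter Λ
  | .right _ next, side, big, i => num side big (next i)
  | .left _ next, true, big, i => num false big (next i)
  | .left _ next, false, big, i => aux true big (next i)
  | _, _, _, _ => filler

/-- The productions of the tag system of a program. -/
def production (P : Λ → StackInstruction Λ) : TagLetter Λ → List (TagLetter Λ)
  | filler => [filler]
  | halt => [filler]
  | num side big ℓ => numProduction ℓ (P ℓ) side big
  | aux false big ℓ => [mid true big ℓ]
  | aux true big ℓ => [num true big ℓ, filler]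
  | mid side big ℓ => [out side big true ℓ, out side big false ℓ]
  | out false true false ℓ => [filler, target (P ℓ) false true false, filler]
  | out side big i ℓ => [target (P ℓ) side big i, filler]

/-- The tag system of a program on two stacks. -/
def system (P : Λ → StackInstruction Λ) : TagSystem (TagLetter Λ) :=
  ⟨production P, halt⟩

theorem production_ne_nil (P : Λ → StackInstruction Λ) (a : TagLetter Λ) :
    production P a ≠ [] := by
  rcases a with _ | _ | ⟨side, big, ℓ⟩ | ⟨_ | _, _, _⟩ | _ | ⟨_ | _, _ | _, _ | _, _⟩ <;>
    simp only [production, ne_eq, reduceCtorEq, not_false_eq_true]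
  cases P ℓ <;> cases side <;> cases big <;> simp [numProduction, push]

/-- The word for a configuration of the program. -/
def word (c : Λ × ℕ × ℕ) : List (TagLetter Λ) :=
  pairWord filler (num false true c.1) (num false false c.1) (num true true c.1)
    (num true false c.1) c.2.1 c.2.2

/-- The word in the middle of an instruction. The units of the second number are not separated by
fillers, so reading it in pairs halves the number, and the shift that remains at the end is its
lowest bit. -/
def midWord (ℓ : Λ) (u v : ℕ) : List (TagLetter Λ) :=
  mid false true ℓ :: filler :: (repeatWord u [mid false false ℓ, filler] ++
    mid true true ℓ :: repeatWord v [mid true false ℓ])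

/-- The word at the end of an instruction, by the bit that has been popped. -/
def targetWord (I : StackInstruction Λ) (i : Bool) (u v : ℕ) : List (TagLetter Λ) :=
  pairWord filler (target I false true i) (target I false false i) (target I true true i)
    (target I true false i) u v

theorem push_append_repeatWord (a : Bool) (ℓ : Λ) (u : ℕ) :
    push a ℓ true ++ repeatWord u (push a ℓ false) =
      mid false true ℓ :: filler :: repeatWord (Nat.bit a u) [mid false false ℓ, filler] := by
  cases a <;> simp [push, Nat.bit_val, repeatWord_succ, repeatWord_two_mul]

variable {P : Λ → StackInstruction Λ}

local notation:50 w " ⟶+ " w':51 => TagSystem.Reaches₁ (system P) w w'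

theorem reaches₁_midWord (ℓ : Λ) (u v : ℕ) :
    midWord ℓ u v ⟶+ mid true true ℓ :: (repeatWord v [mid true false ℓ] ++
      out false true true ℓ :: out false true false ℓ ::
        repeatWord u [out false false true ℓ, out false false false ℓ]) := by
  simpa [midWord, system, production] using reaches₁_cons_repeatWord (T := system P)
    (a := mid false true ℓ) (c := mid false false ℓ) (by simp [system]) (by simp [system])
    filler filler u (mid true true ℓ :: repeatWord v [mid true false ℓ])

theorem reaches₁_midWord_odd (ℓ : Λ) (u v : ℕ) :
    midWord ℓ u (2 * v + 1) ⟶+ targetWord (P ℓ) true u v := by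
  let U : List (TagLetter Λ) := out false true true ℓ :: out false true false ℓ ::
    repeatWord u [out false false true ℓ, out false false false ℓ]
  let V : List (TagLetter Λ) := out true true true ℓ :: out true true false ℓ ::
    repeatWord v [out true false true ℓ, out true false false ℓ]
  let U' : List (TagLetter Λ) := target (P ℓ) false true true :: filler ::
    repeatWord u [target (P ℓ) false false true, filler]
  calc midWord ℓ u (2 * v + 1)
    _ ⟶+ mid true true ℓ :: mid true false ℓ ::
        (repeatWord v [mid true false ℓ, mid true false ℓ] ++ U) := by
      simpa [repeatWord_succ, repeatWord_two_mul] using reaches₁_midWord ℓ u (2 * v + 1)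
    _ ⟶+ U ++ V := by
      simpa [system, production, V] using reaches₁_cons_repeatWord (T := system P)
        (a := mid true true ℓ) (c := mid true false ℓ) (by simp [system]) (by simp [system]) _ _ v U
    _ ⟶+ V ++ U' := by
      simpa [system, production, U, U'] using reaches₁_cons_repeatWord (T := system P)
        (a := out false true true ℓ) (c := out false false true ℓ) (by simp [system])
        (by simp [system]) _ _ u V
    _ ⟶+ targetWord (P ℓ) true u v := by
      simpa [system, production, V, U', targetWord, pairWord] using
        reaches₁_cons_repeatWord (T := system P) (a := out true true true ℓ)
          (c := out true false true ℓ) (by simp [system]) (by simp [system]) _ _ v U'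

theorem reaches₁_midWord_even (ℓ : Λ) (u v : ℕ) :
    midWord ℓ u (2 * v) ⟶+ targetWord (P ℓ) false u v := by
  let U : List (TagLetter Λ) := out false true false ℓ ::
    repeatWord u [out false false true ℓ, out false false false ℓ]
  let V : List (TagLetter Λ) := out true true false ℓ ::
    repeatWord v [out true false true ℓ, out true false false ℓ]
  let U' : List (TagLetter Λ) := target (P ℓ) false true false :: filler ::
    repeatWord u [target (P ℓ) false false false, filler]
  calc midWord ℓ u (2 * v)
    _ ⟶+ mid true true ℓ :: (repeatWord v [mid true false ℓ, mid true false ℓ] ++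
        out false true true ℓ :: U) := by
      simpa [repeatWord_two_mul] using reaches₁_midWord ℓ u (2 * v)
    _ ⟶+ U ++ out true true true ℓ :: V := by
      simpa [system, production, V] using reaches₁_shift (T := system P)
        (a := mid true true ℓ) (d := mid true false ℓ) (by simp [system]) (by simp [system]) _ _ v U
    _ ⟶+ V ++ filler :: U' := by
      simpa [system, production, U, U'] using reaches₁_shift (T := system P)
        (a := out false true false ℓ) (d := out false false false ℓ) (by simp [system])
        (by simp [system]) _ _ u V
    _ ⟶+ targetWord (P ℓ) false u v := by
      simpa [system, production, V, U', targetWord, pairWord] using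
        reaches₁_shift (T := system P) (a := out true true false ℓ)
          (d := out true false false ℓ) (by simp [system]) (by simp [system]) _ _ v U'

theorem reaches₁_targetWord (ℓ : Λ) (u v : ℕ) :
    midWord ℓ u v ⟶+ targetWord (P ℓ) v.bodd u v.div2 := by
  rw [← Nat.bit_bodd_div2 v, Nat.bodd_bit, Nat.div2_bit]
  cases v.bodd
  · exact reaches₁_midWord_even ℓ u v.div2
  · exact reaches₁_midWord_odd ℓ u v.div2

theorem reaches₁_word (ℓ : Λ) (u v : ℕ) :
    word (ℓ, u, v) ⟶+ numProduction ℓ (P ℓ) false true ++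
      repeatWord u (numProduction ℓ (P ℓ) false false) ++
      (numProduction ℓ (P ℓ) true true ++ repeatWord v (numProduction ℓ (P ℓ) true false)) :=
  reaches₁_pairWord (by simp [system]) (by simp [system]) (by simp [system]) (by simp [system]) u v

theorem reaches₁_word_of_right {ℓ : Λ} {a : Bool} {next : Bool → Λ} (h : P ℓ = .right a next)
    (u v : ℕ) : word (ℓ, u, v) ⟶+ word (next v.bodd, Nat.bit a u, v.div2) :=
  calc word (ℓ, u, v)
    _ ⟶+ midWord ℓ (Nat.bit a u) v := by
      simpa [h, numProduction, push_append_repeatWord, midWord] using reaches₁_word (P := P) ℓ u v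
    _ ⟶+ word (next v.bodd, Nat.bit a u, v.div2) := by
      simpa [h, targetWord, target, word] using reaches₁_targetWord (P := P) ℓ (Nat.bit a u) v

-- The two numbers change places for the move and are swapped back after it.
theorem reaches₁_word_of_left {ℓ : Λ} {a : Bool} {next : Bool → Λ} (h : P ℓ = .left a next)
    (u v : ℕ) : word (ℓ, u, v) ⟶+ word (next u.bodd, u.div2, Nat.bit a v) := by
  calc word (ℓ, u, v)
    _ ⟶+ pairWord filler (num true true ℓ) (num true false ℓ) (aux false true ℓ)
        (aux false false ℓ) v u := by
      apply reaches₁_pairWord_rotate <;> simp [system, production, numProduction, h]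
    _ ⟶+ midWord ℓ (Nat.bit a v) u := by
      simpa [system, production, h, numProduction, push_append_repeatWord, midWord] using
        reaches₁_pairWord (T := system P) (x := filler) (A := num true true ℓ)
          (a := num true false ℓ) (B := aux false true ℓ) (b := aux false false ℓ)
          (by simp [system]) (by simp [system]) (by simp [system]) (by simp [system]) v u
    _ ⟶+ targetWord (P ℓ) u.bodd (Nat.bit a v) u.div2 := reaches₁_targetWord _ _ _
    _ ⟶+ word (next u.bodd, u.div2, Nat.bit a v) := by
      simp only [h, targetWord, target]
      apply reaches₁_pairWord_rotate <;> simp [system, production]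

theorem reaches₁_word_of_goto {ℓ ℓ' : Λ} (h : P ℓ = .goto ℓ') (u v : ℕ) :
    word (ℓ, u, v) ⟶+ word (ℓ', u, v) := by
  simpa [numProduction, pairWord, word, h] using reaches₁_word (P := P) ℓ u v

theorem reaches₁_word_of_stackStep {c c' : Λ × ℕ × ℕ} (h : stackStep P c = some c') :
    word c ⟶+ word c' := by
  obtain ⟨ℓ, u, v⟩ := c
  cases hP : P ℓ <;> simp only [stackStep, hP, Option.some.injEq, reduceCtorEq] at h <;> subst h
  · exact reaches₁_word_of_right hP u v
  · exact reaches₁_word_of_left hP u v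
  · exact reaches₁_word_of_goto hP u v

theorem exists_reaches₁_halt {ℓ : Λ} {a : Bool} (h : P ℓ = .halt a) (u v : ℕ) :
    ∃ w, w.length = 2 * (2 * u + 2 * v + a.toNat) + 2 ∧
      word (ℓ, u, v) ⟶+ halt :: filler :: w := by
  refine ⟨(bif a then [filler, filler] else []) ++
    (repeatWord u [filler, filler, filler, filler] ++
      filler :: filler :: repeatWord v [filler, filler, filler, filler]), ?_, ?_⟩
  · cases a <;> simp <;> ring
  · simpa [numProduction, h] using reaches₁_word (P := P) ℓ u v

end TagLetter

/-! ## Programs on two stacks on the machine -/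

namespace CivV

open TuringMachine TuringMachine.Config List Relation StateTransition TagSystem

variable {α : Type*} [DecidableEq α] {T : TagSystem α} {letters : List α}

/-- The productions of a tag system, with the letters replaced by their numbers. A letter outside of
the list, like the one on which the system halts, has the length of the list as its number. -/
def numberedProductions (T : TagSystem α) (letters : List α) : List (List ℕ) :=
  letters.map fun a => (T.production a).map letters.idxOf

/-- The configuration of the machine for the word `w` of a tag system. -/
def wordConfig (T : TagSystem α) (letters : List α) (E : ℕ) (w : List α) :
    Config (Fin 10) Improvement :=
  tagConfig (numberedProductions T letters) E (w.map letters.idxOf)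

theorem ne_nil_of_mem_numberedProductions (hT : ∀ a, T.production a ≠ []) :
    ∀ w ∈ numberedProductions T letters, w ≠ [] := by
  simpa [numberedProductions] using fun a _ => hT a

theorem numberedProductions_append_cons {a i : α} {v : List α} (h : T.production a = i :: v)
    (as bs : List α) :
    numberedProductions T (as ++ a :: bs) =
      as.map (fun c => (T.production c).map (as ++ a :: bs).idxOf) ++
        ((as ++ a :: bs).idxOf i :: v.map (as ++ a :: bs).idxOf) ::
        bs.map (fun c => (T.production c).map (as ++ a :: bs).idxOf) := by
  simp [numberedProductions, h]

theorem exists_reaches₁_of_step (hT : ∀ a, T.production a ≠ [])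
    (hl : ∀ a, a ≠ T.halt → a ∈ letters) {w w' : List α} (hw : T.Step w w') (E : ℕ) :
    ∃ E', machine.Reaches₁ (wordConfig T letters E w) (wordConfig T letters E' w') := by
  obtain @⟨a, ha, b, w⟩ := hw
  obtain ⟨as, bs, rfl, has⟩ := eq_append_cons_of_mem (hl a ha)
  obtain ⟨i, v, hiv⟩ := exists_cons_of_ne_nil (hT a)
  have hidx : (as ++ a :: bs).idxOf a = as.length := by
    rw [idxOf_append_of_notMem has, idxOf_cons_self, add_zero]
  refine ⟨as.length + (as ++ a :: bs).idxOf b + 3 + E, ?_⟩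
  have h := reaches_tagConfig (as.map fun c => (T.production c).map (as ++ a :: bs).idxOf)
    ((as ++ a :: bs).idxOf i) (v.map (as ++ a :: bs).idxOf)
    (bs.map fun c => (T.production c).map (as ++ a :: bs).idxOf) (by simpa using fun c _ => hT c)
    E ((as ++ a :: bs).idxOf b) (w.map (as ++ a :: bs).idxOf)
  rw [length_map, ← numberedProductions_append_cons hiv] at h
  simpa only [wordConfig, map_cons, map_append, hidx, hiv] using h

theorem exists_reaches₁_of_reaches₁ (hT : ∀ a, T.production a ≠ [])
    (hl : ∀ a, a ≠ T.halt → a ∈ letters) {w w' : List α} (hw : T.Reaches₁ w w') (E : ℕ) :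
    ∃ E', machine.Reaches₁ (wordConfig T letters E w) (wordConfig T letters E' w') := by
  induction hw with
  | single hw => exact exists_reaches₁_of_step hT hl hw E
  | tail _ hw ih =>
    obtain ⟨E₁, h₁⟩ := ih
    obtain ⟨E₂, h₂⟩ := exists_reaches₁_of_step hT hl hw E₁
    exact ⟨E₂, TransGen.trans h₁ h₂⟩

theorem exists_reaches_halt (hT : ∀ a, T.production a ≠ []) (hl : T.halt ∉ letters) (E : ℕ) (b : α)
    (w : List α) :
    ∃ F, machine.Reaches (wordConfig T letters E (T.halt :: b :: w)) (onLeft 6 [.road] F) ∧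
      F.count .railroad =
        (programRuns (numberedProductions T letters) 0).length + 2 * (w.length + 1) := by
  have hidx : letters.idxOf T.halt = (numberedProductions T letters).length := by
    rw [idxOf_eq_length hl, numberedProductions, length_map]
  rw [wordConfig, map_cons, map_cons, hidx]
  simpa using reaches_halt (ne_nil_of_mem_numberedProductions hT) E (letters.idxOf b)
    (w.map letters.idxOf)

section StackPrograms

variable {Λ : Type} [Fintype Λ] [DecidableEq Λ] (P : Λ → StackInstruction Λ)

/-- The letters of the tag system of a program that have productions. -/
noncomputable def runningLetters (Λ : Type) [Fintype Λ] [DecidableEq Λ] : List (TagLetter Λ) :=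
  (Finset.univ.erase .halt).toList

/-- The program of the machine for a program on two stacks. -/
noncomputable def stackProgramRuns (E : ℕ) : List ℕ :=
  programRuns (numberedProductions (TagLetter.system P) (runningLetters Λ)) E

/-- The configurations of the machine that stand for a configuration of a program on two stacks. -/
def StackConfig (c : Λ × ℕ × ℕ) (C : Config (Fin 10) Improvement) : Prop :=
  ∃ E, C = wordConfig (TagLetter.system P) (runningLetters Λ) E (TagLetter.word c)

/-- The final configurations of the machine for a halting configuration of a program on two stacks.
The number of Railroads tells the sum of the two stacks, and on which instruction the program has
halted. -/
def HaltConfig (c : Λ × ℕ × ℕ) (C : Config (Fin 10) Improvement) : Prop :=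
  ∀ a, P c.1 = .halt a → ∃ F, C = onLeft 6 [.road] F ∧
    F.count .railroad =
      (stackProgramRuns P 0).length + 6 + 4 * (2 * c.2.1 + 2 * c.2.2 + a.toNat)

theorem simulates_machine :
    Simulates (stackStep P) machine.step (StackConfig P) (HaltConfig P) where
  step := by
    rintro c _ c' ⟨E, rfl⟩ hc
    obtain ⟨E', h⟩ := exists_reaches₁_of_reaches₁ (letters := runningLetters Λ)
      (TagLetter.production_ne_nil P) (by simp [runningLetters, TagLetter.system])
      (TagLetter.reaches₁_word_of_stackStep hc) E
    exact ⟨_, ⟨E', rfl⟩, h⟩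
  halt := by
    rintro ⟨ℓ, u, v⟩ _ ⟨E, rfl⟩ hc
    obtain ⟨a, ha⟩ : ∃ a, P ℓ = .halt a := by
      cases h : P ℓ <;> simp [stackStep, h] at hc ⊢
    obtain ⟨w, hw, hword⟩ := TagLetter.exists_reaches₁_halt ha u v
    obtain ⟨E', hrun⟩ := exists_reaches₁_of_reaches₁ (letters := runningLetters Λ)
      (TagLetter.production_ne_nil P) (by simp [runningLetters, TagLetter.system]) hword E
    obtain ⟨F, hhalt, hF⟩ := exists_reaches_halt (T := TagLetter.system P)
      (letters := runningLetters Λ) (TagLetter.production_ne_nil P)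
      (by simp [runningLetters, TagLetter.system]) E' .filler w
    refine ⟨_, hrun.to_reflTransGen.trans hhalt, by rw [onLeft_cons]; rfl, fun b hb => ⟨F, rfl, ?_⟩⟩
    obtain rfl : a = b := by simpa [ha] using hb
    rw [hF, hw, stackProgramRuns]
    ring

theorem repeatWord_pair_append {β : Type*} (n : ℕ) (a b : β) :
    repeatWord n [a, b] ++ [a] = a :: repeatWord n [b, a] := by
  induction n with
  | zero => rfl
  | succ n ih => simp [repeatWord_succ, ih]

theorem flatMap_repeatWord {β γ : Type*} (f : β → List γ) (n : ℕ) (w : List β) :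
    (repeatWord n w).flatMap f = repeatWord n (w.flatMap f) := by
  induction n with
  | zero => rfl
  | succ n ih => simp [repeatWord_succ, ih]

theorem openCode_word {Λ : Type} (g : TagLetter Λ → ℕ) (ℓ : Λ) (n : ℕ) :
    openCode ((TagLetter.word (ℓ, 0, n)).map g) =
      [g (.num false true ℓ), g .filler, g (.num true true ℓ)].flatMap letterCode ++
        repeatWord n ([g .filler, g (.num true false ℓ)].flatMap letterCode) ++
        openCode [g .filler] := by
  rw [← flatMap_repeatWord, ← flatMap_append, ← openCode_append, TagLetter.word, pairWord]
  simp [← repeatWord_pair_append]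

end StackPrograms

-- The machine enters the first configuration of the simulation, whose state is `1`, by a step from
-- its own start state.
theorem exists_machine_simulation {Λ : Type} [Finite Λ] (P : Λ → StackInstruction Λ) (ℓ₀ : Λ) :
    ∃ (l c₁ c₂ c₃ : List Improvement) (k : ℕ), ∀ n,
      ((eval machine.step (onRight 0 l (c₁ ++ repeatWord n c₂ ++ c₃))).Dom ↔
        (eval (stackStep P) (ℓ₀, 0, n)).Dom) ∧
      ∀ ℓ u v a, (ℓ, u, v) ∈ eval (stackStep P) (ℓ₀, 0, n) → P ℓ = .halt a →
        ∃ F, onLeft 6 [.road] F ∈ eval machine.step (onRight 0 l (c₁ ++ repeatWord n c₂ ++ c₃)) ∧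
          F.count .railroad = k + 4 * (2 * u + 2 * v + a.toNat) := by
  classical
  have := Fintype.ofFinite Λ
  let g := (runningLetters Λ).idxOf
  refine ⟨runs .noImprovement (stackProgramRuns P 0) ++ [.noImprovement, .road],
    .road :: .noImprovement :: .noImprovement ::
      [g (.num false true ℓ₀), g .filler, g (.num true true ℓ₀)].flatMap letterCode,
    [g .filler, g (.num true false ℓ₀)].flatMap letterCode, openCode [g .filler],
    (stackProgramRuns P 0).length + 6, fun n => ?_⟩
  have hR : StackConfig P (ℓ₀, 0, n) _ := ⟨0, rfl⟩
  simp only [cons_append, ← openCode_word]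
  rw [reaches_eval (ReflTransGen.single (step_onRight_of_left (q' := 1) (b := .noImprovement) rfl))]
  refine ⟨(simulates_machine P).eval_dom_iff hR, fun ℓ u v a h ha => ?_⟩
  obtain ⟨d, hd, hF⟩ := (simulates_machine P).exists_mem_eval hR h
  obtain ⟨F, rfl, hcount⟩ := hF a ha
  exact ⟨F, hd, hcount⟩

end CivV

/-! ## Partial recursive functions by programs on two stacks -/

section BooleanMachines

open StateTransition Turing

/-- `L` is the binary expansion of `n`, beginning with the lowest digit. It encodes one half of a
tape as a stack. -/
def IsNumber (L : ListBlank Bool) (n : ℕ) : Prop := ∀ i, L.nth i = n.testBit i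

namespace IsNumber

variable {L : ListBlank Bool} {m n : ℕ}

theorem eq (hm : IsNumber L m) (hn : IsNumber L n) : m = n :=
  Nat.eq_of_testBit_eq fun i => (hm i).symm.trans (hn i)

theorem empty : IsNumber ∅ 0 := fun i => by
  simp [show (∅ : ListBlank Bool) = ListBlank.mk [] from rfl, ListBlank.nth_mk]

theorem tail (h : IsNumber L n) : IsNumber L.tail n.div2 := fun i => by
  rw [← ListBlank.nth_succ, h, Nat.testBit_succ, Nat.div2_val]

theorem head (h : IsNumber L n) : L.head = n.bodd := by
  rw [← ListBlank.nth_zero, h, Nat.testBit_zero, Nat.mod_two_of_bodd]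
  cases n.bodd <;> rfl

theorem cons (h : IsNumber L n) (a : Bool) : IsNumber (L.cons a) (Nat.bit a n) := fun i => by
  cases i with
  | zero => simp
  | succ i => rw [ListBlank.nth_succ, ListBlank.tail_cons, h, Nat.testBit_bit_succ]

end IsNumber

/-- The number with the given binary digits, beginning with the lowest one. -/
def bitsNumber (l : List Bool) : ℕ := Nat.ofDigits 2 (l.map Bool.toNat)

theorem isNumber_bitsNumber (l : List Bool) : IsNumber (ListBlank.mk l) (bitsNumber l) := by
  induction l with
  | nil => exact .empty
  | cons a l ih =>
    have h : bitsNumber (a :: l) = Nat.bit a (bitsNumber l) := by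
      rw [bitsNumber, List.map_cons, Nat.ofDigits_cons, Nat.bit_val, add_comm, bitsNumber]
    rw [h, ← ListBlank.cons_mk]
    exact ih.cons a

variable {Λ : Type} [Inhabited Λ]

/-- The instruction on two stacks for a statement of a machine with two symbols, by the symbol `a`
under the head, which is part of the label, and the next state. -/
def stackInstruction (a : Bool) (q : Λ) : TM0.Stmt Bool → StackInstruction (Option (Λ × Bool))
  | .write b => .goto (some (q, b))
  | .move .left => .left a fun b => some (q, b)
  | .move .right => .right a fun b => some (q, b)

/-- The program on two stacks that simulates a machine with two symbols. At the label `none`, the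
first symbol is read. -/
def stackProgram (M : TM0.Machine Bool Λ) {S : Set Λ} (hS : TM0.Supports M S) :
    Option (S × Bool) → StackInstruction (Option (S × Bool))
  | none => .right false fun a => some (⟨default, hS.1⟩, a)
  | some (q, a) =>
    match h : M q a with
    | none => .halt a
    | some s => stackInstruction a ⟨s.1, hS.2 h q.2⟩ s.2

/-- The configuration `c` of a program on two stacks corresponds to the configuration `C` of a
machine with two symbols. -/
def StackRepresents (S : Set Λ) (C : TM0.Cfg Bool Λ) (c : Option (S × Bool) × ℕ × ℕ) : Prop :=
  (∃ h : C.q ∈ S, c.1 = some (⟨C.q, h⟩, C.Tape.head)) ∧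
    IsNumber C.Tape.left c.2.1 ∧ IsNumber C.Tape.right c.2.2

variable {M : TM0.Machine Bool Λ} {S : Set Λ} (hS : TM0.Supports M S)

theorem stackProgram_of_eq_some {q q' : Λ} {a : Bool} {s : TM0.Stmt Bool} (hq : q ∈ S)
    (h : M q a = some (q', s)) :
    stackProgram M hS (some (⟨q, hq⟩, a)) = stackInstruction a ⟨q', hS.2 h hq⟩ s := by
  simp only [stackProgram]
  split <;> rename_i h' <;> cases h.symm.trans h'
  rfl

theorem stackProgram_of_eq_none {q : Λ} {a : Bool} (hq : q ∈ S) (h : M q a = none) :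
    stackProgram M hS (some (⟨q, hq⟩, a)) = .halt a := by
  simp only [stackProgram]
  split <;> rename_i h'
  · rfl
  · cases h.symm.trans h'

theorem simulates_stackProgram :
    Simulates (TM0.step M) (stackStep (stackProgram M hS)) (StackRepresents S) fun C c =>
      StackRepresents S C c ∧ stackProgram M hS c.1 = .halt C.Tape.head where
  step := by
    rintro ⟨q, T⟩ ⟨ℓ, u, v⟩ C' ⟨⟨hq, hℓ⟩, hu, hv⟩ hC
    dsimp only at hq hℓ hu hv
    subst hℓ
    obtain ⟨⟨q', s⟩, hM, rfl⟩ := Option.map_eq_some_iff.1 hC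
    have hP := stackProgram_of_eq_some hS hq hM
    have hq' : q' ∈ S := hS.2 hM hq
    obtain (_ | _) | b := s <;>
      refine ⟨_, ?_, .single (by simp only [stackStep, hP, stackInstruction]; rfl)⟩
    · exact ⟨⟨hq', by simp [Tape.move, hu.head]⟩, hu.tail, hv.cons _⟩
    · exact ⟨⟨hq', by simp [Tape.move, hv.head]⟩, hu.cons _, hv.tail⟩
    · exact ⟨⟨hq', rfl⟩, hu, hv⟩
  halt := by
    rintro ⟨q, T⟩ ⟨ℓ, u, v⟩ h hC
    obtain ⟨⟨hq, hℓ⟩, -, -⟩ := id h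
    dsimp only at hq hℓ
    subst hℓ
    have hP := stackProgram_of_eq_none hS hq (by simpa [TM0.step] using hC)
    exact ⟨_, .refl, by simp [stackStep, hP], h, hP⟩

theorem eval_stackProgram {R : ListBlank Bool} {n : ℕ} (hR : IsNumber R n) :
    ((eval (stackStep (stackProgram M hS)) (none, 0, n)).Dom ↔
      (eval (TM0.step M) ⟨default, Tape.mk' ∅ R⟩).Dom) ∧
    ∀ C ∈ eval (TM0.step M) ⟨default, Tape.mk' ∅ R⟩, ∀ u m, IsNumber C.Tape.left u →
      IsNumber C.Tape.right₀ m → ∃ ℓ v a,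
        (ℓ, u, v) ∈ eval (stackStep (stackProgram M hS)) (none, 0, n) ∧
        stackProgram M hS ℓ = .halt a ∧ Nat.bit a v = m := by
  have h₀ : (some (some (⟨default, hS.1⟩, n.bodd), 0, n.div2)) =
      stackStep (stackProgram M hS) (none, 0, n) := rfl
  have hR₀ : StackRepresents S ⟨default, Tape.mk' ∅ R⟩
      (some (⟨default, hS.1⟩, n.bodd), 0, n.div2) :=
    ⟨⟨hS.1, by simp [← hR.head]⟩, by simpa using IsNumber.empty, by simpa using hR.tail⟩
  rw [reaches_eval (Relation.ReflTransGen.single h₀.symm)]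
  refine ⟨(simulates_stackProgram hS).eval_dom_iff hR₀, fun C hC u m hu hm => ?_⟩
  obtain ⟨⟨ℓ, u', v⟩, hd, ⟨-, hu', hv⟩, hℓ⟩ := (simulates_stackProgram hS).exists_mem_eval hR₀ hC
  obtain rfl := hu'.eq hu
  exact ⟨ℓ, v, _, hd, hℓ, (hv.cons _).eq hm⟩

end BooleanMachines

section Codes

open StateTransition Turing

theorem eval_booleanMachine {Γ Λ σ : Type} [Inhabited Γ] [Inhabited Λ] [Inhabited σ] {n : ℕ}
    {enc : Γ → List.Vector Bool n} {dec : List.Vector Bool n → Γ}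
    (enc0 : enc default = List.Vector.replicate n false) (encdec : ∀ a, dec (enc a) = a)
    (M : Λ → TM1.Stmt Γ Λ σ) (l : List Γ) :
    let bits (l : List Γ) : Tape Bool :=
      Tape.mk' ∅ (ListBlank.mk (l.flatMap fun a => (enc a).toList))
    let M₀ := TM1to0.tr (TM1to1.tr enc dec M)
    ((eval (TM0.step M₀) ⟨default, bits l⟩).Dom ↔ (eval (TM1.step M) (TM1.init l)).Dom) ∧
    ∀ C ∈ eval (TM1.step M) (TM1.init l), ∀ l', C.Tape = Tape.mk₁ l' →
      ∃ C₀ ∈ eval (TM0.step M₀) ⟨default, bits l⟩, C₀.Tape = bits l' := by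
  intro bits M₀
  have htape (l : List Γ) : TM1to1.trTape enc0 (Tape.mk₁ l) = bits l := by
    rw [Tape.mk₁, Tape.mk₂, TM1to1.trTape_mk', TM1to1.trTape', ListBlank.flatMap_mk,
      ListBlank.flatMap_mk]
    rfl
  have hstart : TM1to0.trCfg (TM1to1.tr enc dec M) (TM1to1.trCfg enc enc0 (TM1.init l)) =
      ⟨default, bits l⟩ := by
    rw [← htape]
    rfl
  have h₁ := TM1to1.tr_respects dec M encdec (enc0 := enc0)
  have h₀ := TM1to0.tr_respects (TM1to1.tr enc dec M)
  rw [← hstart]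
  refine ⟨(tr_eval_dom h₀ rfl).trans (tr_eval_dom h₁ rfl), fun C hC l' hl' => ?_⟩
  obtain ⟨_, rfl, hC₁⟩ := tr_eval h₁ rfl hC
  obtain ⟨_, rfl, hC₀⟩ := tr_eval h₀ rfl hC₁
  refine ⟨_, hC₀, ?_⟩
  rw [← htape, ← hl']
  rfl

theorem tape_eq_of_trCfg {K : Type} {Γ : K → Type} {Λ σ : Type} {q q' : Option Λ} {v v' : σ}
    {S : ∀ k, List (Γ k)} {c c' : TM1.Cfg (TM2to1.Γ' K Γ) (TM2to1.Λ' K Γ Λ σ) σ}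
    (h : TM2to1.TrCfg ⟨q, v, S⟩ c) (h' : TM2to1.TrCfg ⟨q', v', S⟩ c') : c.Tape = c'.Tape := by
  obtain ⟨L, hL⟩ := h
  obtain ⟨L', hL'⟩ := h'
  suffices L = L' by rw [this]
  refine ListBlank.ext fun i => funext fun k => ?_
  rw [TM2to1.stk_nth_val i (hL k), TM2to1.stk_nth_val i (hL' k)]

/-- The symbols on the tape of the machine that computes a partial recursive function. -/
abbrev CodeSymbol : Type := TM2to1.Γ' PartrecToTM2.K' fun _ => PartrecToTM2.Γ'

/-- The tape that encodes a list of numbers. -/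
def codeTape (v : List ℕ) : List CodeSymbol :=
  TM2to1.trInit PartrecToTM2.K'.main (PartrecToTM2.trList v)

/-- The first configuration of the machine that computes the function given by a code. -/
def codeConfig (c : ToPartrec.Code) (v : List ℕ) :
    TM1.Cfg CodeSymbol (TM2to1.Λ' PartrecToTM2.K' (fun _ => PartrecToTM2.Γ') PartrecToTM2.Λ'
      (Option PartrecToTM2.Γ')) (Option PartrecToTM2.Γ') :=
  ⟨some (.normal (PartrecToTM2.trNormal c .halt)), none, Tape.mk₁ (codeTape v)⟩

theorem trCfg_codeConfig (c : ToPartrec.Code) (v : List ℕ) :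
    TM2to1.TrCfg (PartrecToTM2.init c v) (codeConfig c v) := by
  let _ : Inhabited PartrecToTM2.Λ' := ⟨PartrecToTM2.trNormal c .halt⟩
  have h : (TM2.init PartrecToTM2.K'.main (PartrecToTM2.trList v) :
      TM2.Cfg (fun _ => PartrecToTM2.Γ') PartrecToTM2.Λ' (Option PartrecToTM2.Γ')) =
      PartrecToTM2.init c v := by
    simp only [TM2.init, PartrecToTM2.init]
    congr
    funext k
    cases k <;> rfl
  rw [← h]
  exact TM2to1.trCfg_init _ _

theorem eval_codeConfig (c : ToPartrec.Code) (v : List ℕ) :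
    let M := TM2to1.tr PartrecToTM2.tr
    ((eval (TM1.step M) (codeConfig c v)).Dom ↔ (c.eval v).Dom) ∧
    ∀ v' ∈ c.eval v, ∃ C ∈ eval (TM1.step M) (codeConfig c v), C.Tape = Tape.mk₁ (codeTape v') := by
  have hinit := trCfg_codeConfig c v
  have h := TM2to1.tr_respects PartrecToTM2.tr
  refine ⟨?_, fun v' hv' => ?_⟩
  · rw [tr_eval_dom h hinit, PartrecToTM2.tr_eval]
    rfl
  · have hhalt : PartrecToTM2.halt v' ∈
        eval (TM2.step PartrecToTM2.tr) (PartrecToTM2.init c v) := by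
      rw [PartrecToTM2.tr_eval]
      exact Part.mem_map _ hv'
    obtain ⟨C, hC, hmem⟩ := tr_eval h hinit hhalt
    exact ⟨C, hmem, tape_eq_of_trCfg hC (trCfg_codeConfig c v')⟩

instance : Fintype PartrecToTM2.K' :=
  ⟨{.main, .rev, .aux, .stack}, fun k => by cases k <;> decide⟩

/-- The number that encodes a list of numbers, by an encoding of the symbols in blocks of bits. -/
def listCode {n : ℕ} (enc : CodeSymbol → List.Vector Bool n) (v : List ℕ) : ℕ :=
  bitsNumber ((codeTape v).flatMap fun a => (enc a).toList)

theorem exists_stackProgram_of_code (c : ToPartrec.Code) :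
    ∃ (Λ : Type) (_ : Finite Λ) (P : Λ → StackInstruction Λ) (ℓ₀ : Λ) (n : ℕ)
      (enc : CodeSymbol → List.Vector Bool n),
      Function.Injective enc ∧ enc default = List.Vector.replicate n false ∧
      ∀ v, ((eval (stackStep P) (ℓ₀, 0, listCode enc v)).Dom ↔ (c.eval v).Dom) ∧
        ∀ v' ∈ c.eval v, ∃ ℓ w a, (ℓ, 0, w) ∈ eval (stackStep P) (ℓ₀, 0, listCode enc v) ∧
          P ℓ = .halt a ∧ Nat.bit a w = listCode enc v' := by
  classical
  let _ : Inhabited PartrecToTM2.Λ' := ⟨PartrecToTM2.trNormal c .halt⟩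
  obtain ⟨n, enc, dec, enc0, encdec⟩ := TM1to1.exists_enc_dec (Γ := CodeSymbol)
  let M₁ := TM2to1.tr PartrecToTM2.tr
  have hS := TM1to0.tr_supports _ (TM1to1.tr_supports (enc := enc) dec M₁
    (TM2to1.tr_supports PartrecToTM2.tr (PartrecToTM2.tr_supports c .halt)))
  refine ⟨_, inferInstance, stackProgram _ hS, none, n, enc,
    Function.LeftInverse.injective encdec, enc0, fun v => ?_⟩
  obtain ⟨hdom₂, hmem₂⟩ := eval_codeConfig c v
  obtain ⟨hdom₁, hmem₁⟩ := eval_booleanMachine enc0 encdec M₁ (codeTape v)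
  obtain ⟨hdom₀, hmem₀⟩ := eval_stackProgram hS (isNumber_bitsNumber _)
  refine ⟨hdom₀.trans (hdom₁.trans hdom₂), fun v' hv' => ?_⟩
  obtain ⟨C₁, hC₁, hT₁⟩ := hmem₂ v' hv'
  obtain ⟨C₀, hC₀, hT₀⟩ := hmem₁ C₁ hC₁ _ hT₁
  refine hmem₀ C₀ hC₀ 0 _ ?_ ?_ <;> rw [hT₀]
  · exact IsNumber.empty
  · rw [Tape.mk'_right₀]
    exact isNumber_bitsNumber _

end Codes

section NumberCodes

open StateTransition Turing

theorem trPosNum_eq_map_bits (m : PosNum) :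
    PartrecToTM2.trPosNum m = (Nat.bits m).map fun b => bif b then .bit1 else .bit0 := by
  induction m with
  | one => simp [PartrecToTM2.trPosNum]
  | bit1 m ih =>
    rw [PartrecToTM2.trPosNum, ih, PosNum.cast_bit1]
    simp [← two_mul]
  | bit0 m ih =>
    rw [PartrecToTM2.trPosNum, ih, PosNum.cast_bit0, ← two_mul,
      Nat.bit0_bits _ (PosNum.to_nat_pos m).ne']
    rfl

theorem trNat_eq_map_bits (n : ℕ) :
    PartrecToTM2.trNat n = n.bits.map fun b => bif b then .bit1 else .bit0 := by
  have h := Num.to_of_nat n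
  rw [PartrecToTM2.trNat]
  cases hn : (n : Num) with
  | zero =>
    obtain rfl : 0 = n := by rwa [hn] at h
    simp [PartrecToTM2.trNum]
  | pos m =>
    rw [hn] at h
    rw [PartrecToTM2.trNum, trPosNum_eq_map_bits, ← h]
    rfl

theorem bits_eq_bodd_cons {n : ℕ} (hn : n ≠ 0) : n.bits = n.bodd :: n.div2.bits := by
  conv_lhs => rw [← Nat.bit_bodd_div2 n]
  refine Nat.bits_append_bit _ _ fun h => by_contra fun hb => hn ?_
  rw [← Nat.bit_bodd_div2 n, h, Bool.eq_false_of_not_eq_true hb]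
  rfl

theorem primrec_bits : Primrec Nat.bits := by
  have h : Primrec₂ fun (_ : Unit) (n : ℕ) => n.bits := by
    refine Primrec.nat_strong_rec _ (g := fun _ l => if l.length = 0 then some [] else
      (l[l.length.div2]?).map fun t => l.length.bodd :: t) ?_ fun _ n => ?_
    · have hl : Primrec fun x : Unit × List (List Bool) => x.2.length :=
        Primrec.list_length.comp Primrec.snd
      refine Primrec.ite (Primrec.eq.comp hl (Primrec.const 0)) (Primrec.const _) ?_
      refine Primrec.option_map (Primrec.list_getElem?.comp Primrec.snd
        (Primrec.nat_div2.comp hl)) ?_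
      exact Primrec.list_cons.comp (Primrec.nat_bodd.comp (hl.comp Primrec.fst)) Primrec.snd
    · obtain rfl | hn := Nat.eq_zero_or_pos n
      · simp
      · have hlt : n.div2 < n := by rw [Nat.div2_val]; omega
        simp [hn.ne', List.getElem?_range hlt, bits_eq_bodd_cons hn.ne']
  exact h.comp (Primrec.const ()) Primrec.id

/-- The number whose digits in base `B` stand for the binary digits of `x`, where the highest digit
of `x` comes first. -/
def digitCode (B : ℕ) (d : Bool → ℕ) (x : ℕ) : ℕ := Nat.ofDigits B (x.bits.reverse.map d)

theorem primrec_digitCode (B : ℕ) (d : Bool → ℕ) : Primrec (digitCode B d) := by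
  have h : Primrec fun x : ℕ => x.bits.foldl (fun s b => d b + B * s) 0 := by
    refine Primrec.list_foldl (h := fun _ p => d p.2 + B * p.1) primrec_bits (Primrec.const 0) ?_
    refine Primrec.nat_add.comp ((Primrec.dom_finite d).comp (Primrec.snd.comp Primrec.snd)) ?_
    exact Primrec.nat_mul.comp (Primrec.const _) (Primrec.fst.comp Primrec.snd)
  refine h.of_eq fun x => ?_
  rw [digitCode, Nat.ofDigits_eq_foldr]
  simp [List.foldl_map]

theorem two_pow_length_le_ofDigits {B : ℕ} {l : List ℕ} (hB : 2 ≤ B) (hl : ∀ a ∈ l, a ≠ 0) :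
    2 ^ l.length ≤ Nat.ofDigits B l + 1 := by
  induction l with
  | nil => simp
  | cons a l ih =>
    have ha : a ≠ 0 := hl a List.mem_cons_self
    have ih := ih fun b hb => hl b (List.mem_cons_of_mem _ hb)
    have hmul : 2 * Nat.ofDigits B l ≤ B * Nat.ofDigits B l := Nat.mul_le_mul_right _ hB
    rw [Nat.ofDigits_cons, List.length_cons, pow_succ]
    omega

section

variable {B : ℕ} {d : Bool → ℕ}

theorem one_lt_base (h0 : ∀ b, d b ≠ 0) (hlt : ∀ b, d b < B) : 1 < B :=
  (Nat.one_le_iff_ne_zero.2 (h0 true)).trans_lt (hlt true)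

theorem le_digitCode (h0 : ∀ b, d b ≠ 0) (hlt : ∀ b, d b < B) (x : ℕ) : x ≤ digitCode B d x := by
  have hx : x < 2 ^ x.bits.length := by
    rw [Nat.size_eq_bits_len]
    exact Nat.lt_size_self x
  have h := two_pow_length_le_ofDigits (l := x.bits.reverse.map d) (one_lt_base h0 hlt)
    (List.forall_mem_map.2 fun b _ => h0 b)
  rw [List.length_map, List.length_reverse] at h
  exact Nat.lt_succ_iff.1 (hx.trans_le h)

theorem digitCode_injective (hd : Function.Injective d) (h0 : ∀ b, d b ≠ 0) (hlt : ∀ b, d b < B) :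
    Function.Injective (digitCode B d) := fun x y hxy => by
  have hdigits (x : ℕ) : Nat.digits B (digitCode B d x) = x.bits.reverse.map d :=
    Nat.digits_ofDigits _ (one_lt_base h0 hlt) _
      (List.forall_mem_map.2 fun b _ => hlt b) fun hne => by
      obtain ⟨b, -, hb⟩ := List.mem_map.1 (List.getLast_mem hne)
      rw [← hb]
      exact h0 b
  have h : x.bits.reverse.map d = y.bits.reverse.map d := by rw [← hdigits, hxy, hdigits]
  have hbits := List.reverse_injective (List.map_injective_iff.2 hd h)
  rw [← Nat.ofDigits_digits 2 x, Nat.digits_two_eq_bits, hbits, ← Nat.digits_two_eq_bits,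
    Nat.ofDigits_digits]

end

section Blocks

variable {α : Type*} {n : ℕ} (enc : α → List.Vector Bool n)

theorem bitsNumber_flatMap (l : List α) :
    bitsNumber (l.flatMap fun a => (enc a).toList) =
      Nat.ofDigits (2 ^ n) (l.map fun a => bitsNumber (enc a).toList) := by
  induction l with
  | nil => rfl
  | cons a l ih =>
    rw [List.map_cons, Nat.ofDigits_cons, ← ih]
    simp [bitsNumber, Nat.ofDigits_append]

theorem lt_two_of_mem_map_toNat {l : List Bool} : ∀ a ∈ l.map Bool.toNat, a < 2 :=
  List.forall_mem_map.2 fun b _ => b.toNat_lt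

theorem bitsNumber_lt (a : α) : bitsNumber (enc a).toList < 2 ^ n := by
  simpa [bitsNumber] using Nat.ofDigits_lt_base_pow_length one_lt_two
    (lt_two_of_mem_map_toNat (l := (enc a).toList))

theorem bitsNumber_toList_injective (henc : Function.Injective enc) :
    Function.Injective fun a => bitsNumber (enc a).toList := fun a b h => by
  have htoNat : Function.Injective Bool.toNat := by decide
  refine henc (List.Vector.toList_injective (List.map_injective_iff.2 htoNat ?_))
  exact Nat.ofDigits_inj_of_len_eq one_lt_two (by simp) lt_two_of_mem_map_toNat
    lt_two_of_mem_map_toNat h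

theorem bitsNumber_ne_zero [Inhabited α] (henc : Function.Injective enc)
    (h0 : enc default = List.Vector.replicate n false) {a : α} (ha : a ≠ default) :
    bitsNumber (enc a).toList ≠ 0 := fun h => ha <| bitsNumber_toList_injective enc henc <| by
  dsimp only
  rw [h, h0]
  simp [bitsNumber, List.Vector.replicate, Nat.ofDigits_replicate_zero]

end Blocks

/-- The symbol on the main stack, by its bottom mark. -/
def mainSymbol (bottom : Bool) (s : PartrecToTM2.Γ') : CodeSymbol :=
  (bottom, Function.update (fun _ => none) PartrecToTM2.K'.main (some s))

/-- The symbol for a binary digit. -/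
def bitSymbol (b : Bool) : CodeSymbol := mainSymbol false (bif b then .bit1 else .bit0)

theorem bitSymbol_injective : Function.Injective bitSymbol := fun b b' h => by
  have h := congrFun (congrArg Prod.snd h) PartrecToTM2.K'.main
  cases b <;> cases b' <;> simp [bitSymbol, mainSymbol] at h ⊢

theorem bitSymbol_ne_default (b : Bool) : bitSymbol b ≠ default := fun h => by
  have h := congrFun (congrArg Prod.snd h) PartrecToTM2.K'.main
  simp only [bitSymbol, mainSymbol, Function.update_self] at h
  exact Option.some_ne_none _ h

theorem codeTape_singleton (x : ℕ) :
    codeTape [x] = mainSymbol true .cons :: x.bits.reverse.map bitSymbol := by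
  have h : (PartrecToTM2.trList [x]).reverse =
      .cons :: x.bits.reverse.map fun b => bif b then .bit1 else .bit0 := by
    simp [PartrecToTM2.trList, trNat_eq_map_bits]
  rw [codeTape, TM2to1.trInit, h]
  exact congrArg (_ :: ·) (List.map_map ..)

theorem listCode_singleton {n : ℕ} (enc : CodeSymbol → List.Vector Bool n) (x : ℕ) :
    listCode enc [x] = bitsNumber (enc (mainSymbol true .cons)).toList +
      2 ^ n * digitCode (2 ^ n) (fun b => bitsNumber (enc (bitSymbol b)).toList) x := by
  rw [listCode, codeTape_singleton, bitsNumber_flatMap, List.map_cons, Nat.ofDigits_cons,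
    List.map_map]
  rfl

theorem exists_stackProgram_of_partrec {f : ℕ →. ℕ} (hf : Partrec f) :
    ∃ (Λ : Type) (_ : Finite Λ) (P : Λ → StackInstruction Λ) (ℓ₀ : Λ) (g : ℕ → ℕ),
      Primrec g ∧ Function.Injective g ∧ (∀ y, y ≤ g y) ∧
      ∀ x, ((eval (stackStep P) (ℓ₀, 0, g x)).Dom ↔ (f x).Dom) ∧
        ∀ y ∈ f x, ∃ ℓ u v a, (ℓ, u, v) ∈ eval (stackStep P) (ℓ₀, 0, g x) ∧
          P ℓ = .halt a ∧ 2 * u + 2 * v + a.toNat = g y := by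
  obtain ⟨c, hc⟩ := ToPartrec.Code.exists_code (Nat.Partrec'.part_iff₁.2 hf)
  obtain ⟨Λ, hΛ, P, ℓ₀, n, enc, henc, h0, h⟩ := exists_stackProgram_of_code c
  let d (b : Bool) : ℕ := bitsNumber (enc (bitSymbol b)).toList
  have hinj : Function.Injective d :=
    (bitsNumber_toList_injective enc henc).comp bitSymbol_injective
  have hne (b : Bool) : d b ≠ 0 := bitsNumber_ne_zero enc henc h0 (bitSymbol_ne_default b)
  have hlt (b : Bool) : d b < 2 ^ n := bitsNumber_lt enc _
  refine ⟨Λ, hΛ, P, ℓ₀, fun x => listCode enc [x], ?_, ?_, ?_, fun x => ?_⟩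
  · simp only [listCode_singleton]
    exact Primrec.nat_add.comp (Primrec.const _)
      (Primrec.nat_mul.comp (Primrec.const _) (primrec_digitCode _ d))
  · intro x y hxy
    simp only [listCode_singleton] at hxy
    exact digitCode_injective hinj hne hlt
      (Nat.eq_of_mul_eq_mul_left (by positivity) (Nat.add_left_cancel hxy))
  · intro y
    simp only [listCode_singleton]
    calc y ≤ digitCode (2 ^ n) d y := le_digitCode hne hlt y
      _ ≤ 2 ^ n * digitCode (2 ^ n) d y := Nat.le_mul_of_pos_left _ (by positivity)
      _ ≤ _ := Nat.le_add_left _ _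
  · obtain ⟨hdom, hmem⟩ := h [x]
    have hx : c.eval [x] = pure <$> f x := hc ⟨[x], rfl⟩
    rw [hx] at hdom hmem
    refine ⟨hdom, fun y hy => ?_⟩
    obtain ⟨ℓ, w, a, hw, hℓ, ha⟩ := hmem [y] (Part.mem_map _ hy)
    refine ⟨ℓ, 0, w, a, hw, hℓ, ?_⟩
    simp only [← ha, Nat.bit_val]
    ring

end NumberCodes

/-! ## Descriptions of machines -/

namespace TuringMachine

section Descriptions

open StateTransition

/-- An instruction of a described machine: in a state, on reading a symbol, write a symbol, move
(to the right if the Boolean is true) and go to a state. -/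
abbrev DescribedInstruction : Type := ℕ × ℕ × ℕ × Bool × ℕ

/-- The instructions of a machine, and a configuration of it by state and the two halves of its
tape. -/
abbrev DescribedConfig : Type := List DescribedInstruction × ℕ × List ℕ × List ℕ

/-- The start of the described machine on an input word. -/
def describedInit (x : Description × List ℕ) : DescribedConfig :=
  (x.1.2.2.2, x.1.2.2.1, [], x.2)

/-- The first instruction that applies to a state and a symbol. -/
def lookup (I : List DescribedInstruction) (a : ℕ × ℕ) : Option DescribedInstruction :=
  (I.filter fun i => (i.1, i.2.1) = a).head?

/-- One step of a described machine. -/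
def describedStep (C : DescribedConfig) : Option DescribedConfig :=
  (lookup C.1 (C.2.1, C.2.2.2.headI)).map fun i =>
    (C.1, i.2.2.2.2, bif i.2.2.2.1 then (i.2.2.1 :: C.2.2.1, C.2.2.2.tail)
      else (C.2.2.1.tail, C.2.2.1.headI :: i.2.2.1 :: C.2.2.2.tail))

theorem primrec_describedInit : Primrec describedInit := by
  have h : Primrec fun x : Description × List ℕ => x.1.2.2 :=
    Primrec.snd.comp (Primrec.snd.comp Primrec.fst)
  exact Primrec.pair (Primrec.snd.comp h)
    (Primrec.pair (Primrec.fst.comp h) (Primrec.pair (Primrec.const []) Primrec.snd))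

theorem primrec_lookup : Primrec₂ lookup := by
  have h : PrimrecRel fun (i : DescribedInstruction) (a : ℕ × ℕ) => (i.1, i.2.1) = a :=
    Primrec.eq.comp (Primrec.pair (Primrec.fst.comp Primrec.fst)
      (Primrec.fst.comp (Primrec.snd.comp Primrec.fst))) Primrec.snd
  exact Primrec.list_head?.comp h.listFilter

theorem primrec_describedStep : Primrec describedStep := by
  have hstate : Primrec fun C : DescribedConfig => C.2.1 := Primrec.fst.comp Primrec.snd
  have hleft : Primrec fun C : DescribedConfig => C.2.2.1 :=
    Primrec.fst.comp (Primrec.snd.comp Primrec.snd)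
  have hright : Primrec fun C : DescribedConfig => C.2.2.2 :=
    Primrec.snd.comp (Primrec.snd.comp Primrec.snd)
  have haction : Primrec fun x : DescribedConfig × DescribedInstruction => x.2.2.2 :=
    Primrec.snd.comp (Primrec.snd.comp Primrec.snd)
  have hwrite := Primrec.fst.comp haction
  have hmove := Primrec.fst.comp (Primrec.snd.comp haction)
  have hnext := Primrec.snd.comp (Primrec.snd.comp haction)
  have hl := hleft.comp (Primrec.fst (β := DescribedInstruction))
  have hr := Primrec.list_tail.comp (hright.comp (Primrec.fst (β := DescribedInstruction)))
  have hmoveRight := Primrec.pair (Primrec.list_cons.comp hwrite hl) hr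
  have hmoveLeft := Primrec.pair (Primrec.list_tail.comp hl)
    (Primrec.list_cons.comp (Primrec.list_headI.comp hl) (Primrec.list_cons.comp hwrite hr))
  refine Primrec.option_map (primrec_lookup.comp Primrec.fst
    (Primrec.pair hstate (Primrec.list_headI.comp hright))) ?_
  exact Primrec.pair (Primrec.fst.comp Primrec.fst)
    (Primrec.pair hnext (Primrec.cond hmove hmoveRight hmoveLeft))

theorem partrec_eval {σ : Type} [Primcodable σ] {f : σ → Option σ} (hf : Primrec f) :
    Partrec (eval f) := by
  refine Partrec.fix (Computable.partrec (Primrec.to_comp ?_))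
  refine (Primrec.option_casesOn hf (Primrec.sumInl) (Primrec.sumInr.comp Primrec.snd).to₂).of_eq
    fun a => ?_
  cases f a <;> rfl

theorem find?_eq_of_unique {α : Type*} {p : α → Bool} {l : List α} {o : Option α}
    (h : ∀ a, a ∈ l ∧ p a ↔ o = some a) : l.find? p = o := by
  cases hf : l.find? p with
  | some a => exact ((h a).1 ⟨List.mem_of_find?_eq_some hf, List.find?_some hf⟩).symm
  | none =>
    cases o with
    | none => rfl
    | some a =>
      obtain ⟨ha, hp⟩ := (h a).2 rfl
      exact absurd hp (List.find?_eq_none.1 hf a ha)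

variable {n k : ℕ} (M : TuringMachine (Fin (n + 1)) (Fin (k + 1)))

theorem lookup_description (q : Fin (n + 1)) (s : Fin (k + 1)) :
    lookup M.description.2.2.2 (q, s) =
      (M.δ q s).map fun a => (q.val, s.val, a.2.1.val, isRight a.2.2, a.1.val) := by
  rw [lookup, List.head?_filter]
  refine find?_eq_of_unique fun i => ?_
  have hmem : i ∈ M.description.2.2.2 ↔
      ∃ q s a, M.δ q s = some a ∧ (q.val, s.val, a.2.1.val, isRight a.2.2, a.1.val) = i := by
    simp [description]
  rw [hmem, Option.map_eq_some_iff, decide_eq_true_iff, Prod.mk.injEq]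
  constructor
  · rintro ⟨⟨q', s', a, ha, rfl⟩, hq, hs⟩
    obtain rfl := Fin.ext hq
    obtain rfl := Fin.ext hs
    exact ⟨a, ha, rfl⟩
  · rintro ⟨a, ha, rfl⟩
    exact ⟨⟨q, s, a, ha, rfl⟩, rfl, rfl⟩

/-- `D` is a configuration of the described machine that shows the configuration `C` of `M`. The
tape may be written as two lists in several ways. -/
def Describes (C : Config (Fin (n + 1)) (Fin (k + 1))) (D : DescribedConfig) : Prop :=
  ∃ l r : List (Fin (k + 1)), C.tape = Turing.Tape.mk₂ l r ∧
    D = (M.description.2.2.2, C.state.val, l.map Fin.val, r.map Fin.val)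

theorem describes_init (w : List (Fin (k + 1))) :
    M.Describes (M.init [] w) (describedInit (M.description, w.map Fin.val)) :=
  ⟨[], w, rfl, rfl⟩

theorem headI_map_val (l : List (Fin (k + 1))) : (l.map Fin.val).headI = l.headI.val := by
  cases l <;> rfl

theorem describedStep_eq (q : Fin (n + 1)) (l r : List (Fin (k + 1))) :
    describedStep (M.description.2.2.2, q.val, l.map Fin.val, r.map Fin.val) =
      (M.δ q r.headI).map fun a => (M.description.2.2.2, a.1.val,
        bif isRight a.2.2 then ((a.2.1 :: l).map Fin.val, r.tail.map Fin.val)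
          else (l.tail.map Fin.val, (l.headI :: a.2.1 :: r.tail).map Fin.val)) := by
  simp only [describedStep, headI_map_val, lookup_description, Option.map_map]
  congr 1
  funext a
  simp [List.map_tail]

theorem simulates_describedStep : Simulates M.step describedStep M.Describes M.Describes where
  step := by
    rintro ⟨q, _⟩ _ C' ⟨l, r, rfl, rfl⟩ hC
    obtain ⟨⟨q', s, d⟩, hδ, rfl⟩ := Option.map_eq_some_iff.1 hC
    replace hδ : M.δ q r.headI = some (q', s, d) := by
      simpa [Turing.Tape.mk₂, Turing.Tape.mk'] using hδ
    refine ⟨_, ?_, .single (by rw [describedStep_eq, hδ]; rfl)⟩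
    cases d
    · refine ⟨l.tail, l.headI :: s :: r.tail, ?_, rfl⟩
      simp [Turing.Tape.mk₂, Turing.Tape.mk', Turing.Tape.write, Turing.Tape.move]
    · refine ⟨s :: l, r.tail, ?_, rfl⟩
      simp [Turing.Tape.mk₂, Turing.Tape.mk', Turing.Tape.write, Turing.Tape.move]
  halt := by
    rintro ⟨q, _⟩ _ ⟨l, r, rfl, rfl⟩ hC
    have hδ : M.δ q r.headI = none := by
      simpa [step, Turing.Tape.mk₂, Turing.Tape.mk'] using hC
    exact ⟨_, .refl, by rw [describedStep_eq, hδ]; rfl, l, r, rfl, rfl⟩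

end Descriptions

end TuringMachine

/-! ## Universality -/

section Universality

open StateTransition

theorem count_eq_of_blankExtends {Γ : Type*} [Inhabited Γ] [DecidableEq Γ] {s : Γ}
    (hs : s ≠ default) {l l' : List Γ} (h : Turing.BlankExtends l l') :
    l.count s = l'.count s := by
  obtain ⟨n, rfl⟩ := h
  simp [List.count_replicate, hs.symm]

theorem count_eq_of_listBlank_mk_eq {Γ : Type*} [Inhabited Γ] [DecidableEq Γ] {s : Γ}
    (hs : s ≠ default) {l l' : List Γ} (h : Turing.ListBlank.mk l = Turing.ListBlank.mk l') :
    l.count s = l'.count s :=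
  (Quotient.exact h).elim (count_eq_of_blankExtends hs) fun h =>
    (count_eq_of_blankExtends hs h).symm

theorem count_eq_of_tape_mk₂_eq {Γ : Type*} [Inhabited Γ] [DecidableEq Γ] {s : Γ}
    (hs : s ≠ default) {l r l' r' : List Γ} (h : Turing.Tape.mk₂ l r = Turing.Tape.mk₂ l' r') :
    l.count s + r.count s = l'.count s + r'.count s := by
  have hleft := congrArg Turing.Tape.left h
  have hright := congrArg Turing.Tape.right₀ h
  simp only [Turing.Tape.mk₂, Turing.Tape.mk'_left, Turing.Tape.mk'_right₀] at hleft hright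
  rw [count_eq_of_listBlank_mk_eq hs hleft, count_eq_of_listBlank_mk_eq hs hright]

theorem TagSystem.primrec_repeatWord {α : Type*} [Primcodable α] (c : List α) :
    Primrec fun n => repeatWord n c := by
  refine (Primrec.nat_rec₁ (f := fun _ l => c ++ l) []
    (Primrec.list_append.comp (Primrec.const c) Primrec.snd)).of_eq fun n => ?_
  induction n with
  | zero => rfl
  | succ n ih => rw [repeatWord_succ, ← ih]

theorem primrec_count {α : Type*} [Primcodable α] [DecidableEq α] (a : α) :
    Primrec fun l : List α => l.count a := by
  have h : PrimrecPred fun b : α => b = a := Primrec.eq.comp Primrec.id (Primrec.const a)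
  refine (Primrec.list_length.comp (Primrec.listFilter h)).of_eq fun l => ?_
  rw [List.count_eq_length_filter]
  congr 1

theorem exists_primrec_leftInverse {g : ℕ → ℕ} (hg : Primrec g) (hinj : Function.Injective g)
    (hle : ∀ y, y ≤ g y) : ∃ g' : ℕ → ℕ, Primrec g' ∧ Function.LeftInverse g' g :=
  ⟨fun m => Nat.findGreatest (fun y => g y = m) m,
    Primrec.nat_findGreatest Primrec.id (Primrec.eq.comp (hg.comp Primrec.snd) Primrec.fst),
    fun y => hinj (Nat.findGreatest_spec (P := fun z => g z = g y) (hle y) rfl)⟩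

namespace TuringMachine

open Encodable

/-- The partial function that runs the machine described by a number on the input word that comes
with it, and returns the number of the final state and tape. -/
def describedRun (x : ℕ) : Part ℕ :=
  (eval describedStep (describedInit ((decode x).getD default))).map fun C => encode C.2

theorem partrec_describedRun : Partrec describedRun :=
  Partrec.map ((partrec_eval primrec_describedStep).comp (Primrec.to_comp
      (primrec_describedInit.comp (Primrec.option_getD.comp Primrec.decode (Primrec.const _)))))
    (Primrec.to_comp (Primrec.encode.comp (Primrec.snd.comp Primrec.snd)))

theorem describedRun_encode (x : Description × List ℕ) :
    describedRun (encode x) =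
      (eval describedStep (describedInit x)).map fun C => encode C.2 := by
  simp only [describedRun, encodek, Option.getD_some]

end TuringMachine

namespace CivV

open TuringMachine TuringMachine.Config TagSystem Encodable

/-- The number that a final tape holds when `k + 4 * m` Railroads stand for `m`. -/
def railroadNumber (k : ℕ) (x : List Improvement × List Improvement) : ℕ :=
  (x.1.count .railroad + x.2.count .railroad - k) / 4

theorem primrec_railroadNumber (k : ℕ) : Primrec (railroadNumber k) :=
  Primrec.nat_div.comp (Primrec.nat_sub.comp (Primrec.nat_add.comp
    ((primrec_count _).comp Primrec.fst) ((primrec_count _).comp Primrec.snd))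
    (Primrec.const k)) (Primrec.const 4)

theorem railroadNumber_eq {q : Fin 10} {k m : ℕ} {F l r : List Improvement}
    (hF : F.count .railroad = k + 4 * m)
    (h : (onLeft q [.road] F).tape = Turing.Tape.mk₂ l r) :
    railroadNumber k (l, r) = m := by
  rw [onLeft_cons] at h
  have hcount := count_eq_of_tape_mk₂_eq (s := Improvement.railroad) (by decide) h
  rw [List.count_nil, List.count_cons_of_ne (by decide), hF] at hcount
  rw [railroadNumber, ← hcount]
  omega

theorem exists_machine_computes {f : ℕ →. ℕ} (hf : Partrec f) :
    ∃ (enc : ℕ → List Improvement × List Improvement)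
      (dec : List Improvement × List Improvement → ℕ), Primrec enc ∧ Primrec dec ∧
      ∀ x, ((machine.run (machine.init (enc x).1 (enc x).2)).Dom ↔ (f x).Dom) ∧
        ∀ y ∈ f x, ∀ E ∈ machine.run (machine.init (enc x).1 (enc x).2),
          ∀ l r, E.tape = Turing.Tape.mk₂ l r → dec (l, r) = y := by
  obtain ⟨Λ, _, P, ℓ₀, g, hg, hinj, hle, hP⟩ := exists_stackProgram_of_partrec hf
  obtain ⟨g', hg', hgg⟩ := exists_primrec_leftInverse hg hinj hle
  obtain ⟨l, c₁, c₂, c₃, k, hU⟩ := exists_machine_simulation P ℓ₀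
  refine ⟨fun x => (l, c₁ ++ repeatWord (g x) c₂ ++ c₃), fun t => g' (railroadNumber k t), ?_,
    hg'.comp (primrec_railroadNumber k), fun x => ⟨(hU (g x)).1.trans (hP x).1, ?_⟩⟩
  · exact Primrec.pair (Primrec.const l) (Primrec.list_append.comp (Primrec.list_append.comp
      (Primrec.const c₁) ((primrec_repeatWord c₂).comp hg)) (Primrec.const c₃))
  · intro y hy E hE l' r' htape
    obtain ⟨ℓ, u, v, a, heval, hhalt, huv⟩ := (hP x).2 y hy
    obtain ⟨F, hF, hcount⟩ := (hU (g x)).2 ℓ u v a heval hhalt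
    cases Part.mem_unique hE hF
    rw [huv] at hcount
    exact (congrArg g' (railroadNumber_eq hcount htape)).trans (hgg y)

theorem machine_isUniversal : machine.IsUniversal := by
  obtain ⟨enc, dec, henc, hdec, h⟩ := exists_machine_computes partrec_describedRun
  refine ⟨fun x => enc (encode x), fun x => (decode (dec x.2)).getD default,
    henc.comp Primrec.encode, Primrec.option_getD.comp
      (Primrec.decode.comp (hdec.comp Primrec.snd)) (Primrec.const _), fun n k M w => ?_⟩
  obtain ⟨hdom, hval⟩ := h (encode (M.description, w.map Fin.val))
  rw [describedRun_encode] at hdom hval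
  have hsim := M.simulates_describedStep
  refine ⟨hdom.trans (hsim.eval_dom_iff (M.describes_init w)), fun D hD E hE l r htape => ?_⟩
  obtain ⟨_, hC, l', r', hD', rfl⟩ := hsim.exists_mem_eval (M.describes_init w) hD
  refine ⟨l', r', hD', ?_⟩
  dsimp only
  rw [hval _ (Part.mem_map _ hC) E hE l r htape, encodek, Option.getD_some]

end CivV

end Universality

/-! ## Commands in the game -/

namespace CivV

section Play

variable {G : GameMap} {S : Session} {P P' : Position} {w : Worker} {i : Improvement}

theorem Play.trans {m n : ℕ} {P'' : Position} (h : Play G S m P P') (h' : Play G S n P' P'') :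
    Play G S (m + n) P P'' := by
  induction h with
  | nil P => simpa only [Nat.zero_add] using h'
  | cons hT _ ih =>
    rw [Nat.add_right_comm]
    exact .cons hT (ih h')

theorem Play.of_legal {o : Order} (h : Legal G S P w o) : Play G S 1 P (act S P w o) := by
  refine .cons (P' := act S P w o) ?_ (.nil _)
  cases w with
  | tape => exact ⟨o, .wait, h, trivial, rfl⟩
  | state => exact ⟨.wait, o, trivial, h, rfl⟩

/-- The position after a Worker has made its tile carry `i`, with no work unfinished. -/
def Position.setImprovement (P : Position) (w : Worker) (i : Improvement) : Position :=
  ⟨Function.update P.improvement (P.worker w) i, 0, P.worker⟩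

theorem Legal.build_congr (hi : P'.improvement = P.improvement) (hw : P'.worker = P.worker)
    (h : Legal G S P w (.build i)) : Legal G S P' w (.build i) := by
  cases i with
  | noImprovement => exact h
  | road => simpa only [Legal, hi, hw] using h
  | railroad => simpa only [Legal, hi, hw] using h

theorem Legal.turns_pos (h : Legal G S P w (.build i)) : 0 < S.turns i := by
  cases i with
  | noImprovement => exact h.elim
  | road => exact S.roadTurns_pos
  | railroad => exact S.railroadTurns_pos

theorem Session.turns_le (S : Session) (i : Improvement) :
    S.turns i ≤ max S.roadTurns S.railroadTurns := by
  cases i <;> simp [turns]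

theorem Play.build_of_progress {d : ℕ} (h : Legal G S P w (.build i))
    (hd : P.progress (P.worker w) i + (d + 1) = S.turns i)
    (h0 : ∀ t ≠ P.worker w, P.progress t = 0) :
    Play G S (d + 1) P (P.setImprovement w i) := by
  induction d generalizing P with
  | zero =>
    have hturn := Play.of_legal h
    have hprogress : Function.update P.progress (P.worker w) 0 = 0 :=
      Function.update_eq_iff.2 ⟨rfl, h0⟩
    rwa [act, if_neg (by omega), hprogress] at hturn
  | succ d ih =>
    have hturn := Play.of_legal h
    rw [act, if_pos (by omega)] at hturn
    rw [Nat.add_comm]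
    refine hturn.trans (ih (P := ⟨P.improvement, _, P.worker⟩) (h.build_congr rfl rfl) ?_ ?_)
    · simp only [and_self, if_true]
      omega
    · rintro t (ht : t ≠ P.worker w)
      funext j
      simp [ht, h0 t ht]

theorem Play.build (h : Legal G S P w (.build i)) (h0 : P.progress = 0) :
    Play G S (S.turns i) P (P.setImprovement w i) := by
  obtain ⟨d, hd⟩ := Nat.exists_eq_add_one.2 h.turns_pos
  rw [hd]
  exact Play.build_of_progress h (by simp [h0, hd]) (by simp [h0])

theorem Play.remove (h : P.improvement (P.worker w) ≠ .noImprovement) (h0 : P.progress = 0) :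
    Play G S 1 P (P.setImprovement w .noImprovement) := by
  have hturn := Play.of_legal (G := G) (S := S) (o := .remove) h
  rwa [act, h0] at hturn

/-- The order can be carried out on a tile that carries `s`. -/
def TapeOrder.Applicable : TapeOrder → Improvement → Prop
  | .keep, _ => True
  | .buildRoad, s => s ≠ .road
  | .buildRailroad, s => s ≠ .railroad
  | .remove, s => s ≠ .noImprovement

-- A Road replaces a Railroad in two stages, which costs the additional turn.
theorem Play.exists_tapeOrder {o : TapeOrder} (hS : S.engineering)
    (ho : o.Applicable (P.improvement (P.worker w))) (h0 : P.progress = 0) :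
    ∃ n ≤ 1 + max S.roadTurns S.railroadTurns,
      Play G S n P (P.setImprovement w (o.result (P.improvement (P.worker w)))) := by
  cases o with
  | keep =>
    refine ⟨0, Nat.zero_le _, ?_⟩
    rw [TapeOrder.result, Position.setImprovement, Function.update_eq_self, ← h0]
    exact .nil P
  | buildRailroad =>
    exact ⟨_, (S.turns_le .railroad).trans (Nat.le_add_left ..), Play.build ⟨hS, ho⟩ h0⟩
  | remove => exact ⟨1, Nat.le_add_right .., Play.remove ho h0⟩
  | buildRoad =>
    by_cases hempty : P.improvement (P.worker w) = .noImprovement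
    · exact ⟨_, (S.turns_le .road).trans (Nat.le_add_left ..), Play.build hempty h0⟩
    · have hbuild : Play G S (S.turns .road) (P.setImprovement w .noImprovement)
          ((P.setImprovement w .noImprovement).setImprovement w .road) :=
        Play.build (Function.update_self ..) rfl
      simp only [Position.setImprovement, Function.update_idem] at hbuild
      exact ⟨_, Nat.add_le_add_left (S.turns_le _) 1, (Play.remove hempty h0).trans hbuild⟩

end Play

section Commands

variable {q : Fin 10} {s : Improvement} {c : Command}

theorem applicable_of_commandTable (h : commandTable q s = some c) : c.tape.Applicable s := by
  fin_cases q <;> cases s <;> cases h <;> simp [TapeOrder.Applicable]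

theorem change_mem_Icc_of_commandTable (h : commandTable q s = some c) :
    c.change ∈ Set.Icc (-5) 3 := by
  fin_cases q <;> cases s <;> cases h <;> simp

theorem add_change_mem_Icc_of_commandTable (h : commandTable q s = some c) :
    (q.val : ℤ) + c.change ∈ Set.Icc 0 9 := by
  fin_cases q <;> cases s <;> cases h <;> simp

theorem toRogozhin_bijective : Function.Bijective toRogozhin := by
  refine ⟨fun s t h => ?_, ?_⟩
  · cases s <;> cases t <;> first | rfl | cases h
  · rintro (_ | _ | _)
    exacts [⟨.noImprovement, rfl⟩, ⟨.road, rfl⟩, ⟨.railroad, rfl⟩]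

theorem rogozhinProgram_toRogozhin (q : Fin 10) (s : Improvement) :
    rogozhinProgram q (toRogozhin s) =
      (machine.δ q s).map fun a => (a.1, toRogozhin a.2.1, a.2.2) := by
  fin_cases q <;> cases s <;> rfl

end Commands

namespace Layout

variable {G : GameMap} (L : Layout G)

theorem strip_notMem_reserved (i : ℤ) : L.strip i ∉ L.reserved :=
  fun h => L.strip_notMem_area i (L.reserved_subset h)

theorem strip_adj_add_offset (p : ℤ) (d : Turing.Dir) :
    hexGraph.Adj (L.strip p) (L.strip (p + offset d)) := by
  cases d with
  | left => simpa [offset, sub_eq_add_neg] using (L.strip_adj (p - 1)).symm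
  | right => exact L.strip_adj p

section Representation

variable {C : TuringMachine.Config (Fin 10) Improvement} {P P' : Position} {c : Command}

theorem exists_represents (C : TuringMachine.Config (Fin 10) Improvement) :
    ∃ P, L.Represents C P := by
  obtain ⟨s, hs, hcard⟩ := Finset.exists_subset_card_eq (s := L.reserved) (n := C.state.val)
    (by rw [L.reserved_card]; omega)
  obtain ⟨t, ht⟩ := Finset.card_pos.1 (by rw [L.reserved_card]; omega : 0 < L.reserved.card)
  refine ⟨⟨Function.extend L.strip C.tape.nth fun u => if u ∈ s then .railroad else .noImprovement,
    0, fun | .tape => L.strip 0 | .state => t⟩, ?_, ⟨0, rfl, fun i => ?_⟩, ht, rfl⟩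
  · rw [← hcard, railroads]
    conv_rhs => rw [← Finset.inter_eq_right.2 hs, ← Finset.filter_mem_eq_inter]
    refine congrArg _ (Finset.filter_congr fun u hu => ?_)
    have hstrip : ¬∃ i, L.strip i = u := by
      rintro ⟨i, rfl⟩
      exact L.strip_notMem_reserved i hu
    dsimp only
    rw [Function.extend_apply' _ _ _ hstrip]
    split_ifs with h <;> simp [h]
  · rw [zero_add]
    dsimp only
    rw [L.strip_injective.extend_apply]

variable {L}

theorem Represents.command_eq (h : L.Represents C P) :
    L.command P = commandTable C.state C.tape.head := by
  obtain ⟨hstate, ⟨p, hp, htape⟩, -, -⟩ := h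
  have hhead := htape 0
  rw [add_zero, ← hp, Turing.Tape.nth_zero] at hhead
  rw [command, hhead]
  exact congrArg (commandTable · _) (Fin.ext hstate)

theorem Represents.step_eq_none_iff (h : L.Represents C P) :
    machine.step C = none ↔ L.command P = none := by
  rw [h.command_eq, TuringMachine.step, machine]
  simp

theorem nth_move_eq_nth_offset_add {Γ : Type*} [Inhabited Γ] (T : Turing.Tape Γ) (d : Turing.Dir)
    (i : ℤ) : (T.move d).nth i = T.nth (offset d + i) := by
  cases d with
  | left => rw [Turing.Tape.move_left_nth, offset, neg_add_eq_sub]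
  | right => rw [Turing.Tape.move_right_nth, offset, add_comm]

theorem improvement_strip_eq_nth_write {T : Turing.Tape Improvement} {p : ℤ} {s : Improvement}
    (hT : ∀ i, P.improvement (L.strip (p + i)) = T.nth i) (hp : P'.improvement (L.strip p) = s)
    (hrest : ∀ t, t ≠ L.strip p → t ∉ L.reserved → P'.improvement t = P.improvement t) (i : ℤ) :
    P'.improvement (L.strip (p + i)) = (T.write s).nth i := by
  rw [Turing.Tape.write_nth]
  split_ifs with hi
  · rw [hi, add_zero, hp]
  · rw [hrest _ (fun e => hi (by simpa using L.strip_injective e)) (L.strip_notMem_reserved _), hT]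

theorem machine_step_eq (h : commandTable C.state C.tape.head = some c) :
    machine.step C = some ⟨Fin.ofNat 10 ((C.state.val : ℤ) + c.change).toNat,
      (C.tape.write (c.tape.result C.tape.head)).move c.dir⟩ := by
  simp [TuringMachine.step, machine, h]

theorem Represents.of_carriesOut (h : L.Represents C P) (hc : L.command P = some c)
    (h' : L.CarriesOut c P P') : ∃ C', machine.step C = some C' ∧ L.Represents C' P' := by
  rw [h.command_eq] at hc
  obtain ⟨hstate, ⟨p, hp, htape⟩, -, -⟩ := h
  obtain ⟨⟨p', hp', hmove, hwrite, hrest⟩, hrail, hworker, hprogress⟩ := h'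
  obtain rfl := L.strip_injective (hp.symm.trans hp')
  have hhead : P.improvement (L.strip p) = C.tape.head := by simpa using htape 0
  rw [hhead] at hwrite
  refine ⟨_, machine_step_eq hc, ?_, ⟨_, hmove, fun i => ?_⟩, hworker, hprogress⟩
  · rw [← hstate, ← hrail, Int.toNat_natCast, Fin.val_ofNat, Nat.mod_eq_of_lt (L.railroads_lt P')]
  · rw [add_assoc, improvement_strip_eq_nth_write htape hwrite hrest, nth_move_eq_nth_offset_add]

end Representation

section StateWorker

variable {S : Session} {P P' P'' : Position} {t : Tile}

theorem play_walk {a b : L.area} (p : (hexGraph.induce L.area).Walk a b)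
    (hP : P.worker .state = a) (ht : P.worker .tape ∉ L.area) :
    Play G S p.length P { P with worker := Function.update P.worker .state b } := by
  induction p generalizing P with
  | nil =>
    rw [← hP, Function.update_eq_self]
    exact .nil P
  | @cons a a' b h p ih =>
    have hadj : hexGraph.Adj a.1 a'.1 := h
    have hlegal : Legal G S P .state (.move a') := by
      refine ⟨by rwa [hP], L.area_traversable a'.2, fun v hv => ?_⟩
      cases v with
      | tape => exact ht (hv ▸ a'.2)
      | state => exact hadj.ne (hP.symm.trans hv)
    have hrest := ih (P := act S P .state (.move a')) (by simp [act]) (by simpa [act] using ht)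
    rw [SimpleGraph.Walk.length_cons, Nat.add_comm]
    simpa [act] using (Play.of_legal hlegal).trans hrest

/-- The greatest distance, within the area, between two reserved tiles. -/
noncomputable def reservedDiam : ℕ :=
  Finset.univ.sup fun x : L.reserved × L.reserved => (hexGraph.induce L.area).dist
    ⟨x.1, L.reserved_subset x.1.2⟩ ⟨x.2, L.reserved_subset x.2.2⟩

/-- The position is one from which the state Worker can set to work: it is on a reserved tile, the
tape Worker is out of its way, and no work is unfinished. -/
def StateReady (P : Position) : Prop :=
  P.worker .tape ∉ L.area ∧ P.worker .state ∈ L.reserved ∧ P.progress = 0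

/-- From `P` to `P'`, only the state Worker has acted, on the reserved tiles, and no work is
unfinished. -/
def StateWork (P P' : Position) : Prop :=
  P'.worker .tape = P.worker .tape ∧ P'.worker .state ∈ L.reserved ∧ P'.progress = 0 ∧
    ∀ t ∉ L.reserved, P'.improvement t = P.improvement t

variable {L}

theorem StateReady.stateWork_self (hP : L.StateReady P) : L.StateWork P P :=
  ⟨rfl, hP.2.1, hP.2.2, fun _ _ => rfl⟩

theorem StateReady.of_stateWork (hP : L.StateReady P) (h : L.StateWork P P') : L.StateReady P' :=
  ⟨h.1 ▸ hP.1, h.2.1, h.2.2.1⟩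

theorem StateWork.trans (h : L.StateWork P P') (h' : L.StateWork P' P'') : L.StateWork P P'' :=
  ⟨h'.1.trans h.1, h'.2.1, h'.2.2.1, fun t ht => (h'.2.2.2 t ht).trans (h.2.2.2 t ht)⟩

theorem StateReady.exists_play_move (hP : L.StateReady P) (ht : t ∈ L.reserved) :
    ∃ n ≤ L.reservedDiam,
      Play G S n P { P with worker := Function.update P.worker .state t } := by
  obtain ⟨p, hp⟩ := L.area_connected.exists_walk_length_eq_dist
    ⟨P.worker .state, L.reserved_subset hP.2.1⟩ ⟨t, L.reserved_subset ht⟩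
  exact ⟨_, hp.trans_le (Finset.le_sup (f := fun x : L.reserved × L.reserved =>
    (hexGraph.induce L.area).dist ⟨x.1, L.reserved_subset x.1.2⟩ ⟨x.2, L.reserved_subset x.2.2⟩)
    (Finset.mem_univ (⟨_, hP.2.1⟩, ⟨t, ht⟩))), L.play_walk p rfl hP.1⟩

variable (L)

theorem stateWork_setImprovement (P : Position) (i : Improvement) (ht : t ∈ L.reserved) :
    L.StateWork P (Position.setImprovement
      { P with worker := Function.update P.worker .state t } .state i) := by
  refine ⟨by simp [Position.setImprovement], by simpa [Position.setImprovement] using ht, rfl,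
    fun u hu => ?_⟩
  simp only [Position.setImprovement, Function.update_self]
  exact Function.update_of_ne (ne_of_mem_of_not_mem ht hu).symm ..

theorem railroads_congr (h : ∀ t ∈ L.reserved, P'.improvement t = P.improvement t) :
    L.railroads P' = L.railroads P :=
  congrArg Finset.card (Finset.filter_congr fun t ht => by rw [h t ht])

theorem railroads_update_railroad (hP : P'.improvement = Function.update P.improvement t .railroad)
    (ht : t ∈ L.reserved) (h : P.improvement t ≠ .railroad) :
    L.railroads P' = L.railroads P + 1 := by
  rw [railroads, railroads, ← Finset.card_insert_of_notMem (a := t) (by simp [h]), hP]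
  congr 1
  ext u
  by_cases hu : u = t
  · simp [hu, ht]
  · simp [hu]

variable {L}

theorem StateReady.exists_buildRailroad (hS : S.engineering) (hP : L.StateReady P)
    (hlt : L.railroads P < 9) :
    ∃ n ≤ L.reservedDiam + max S.roadTurns S.railroadTurns, ∃ P', Play G S n P P' ∧
      L.StateWork P P' ∧ L.railroads P' = L.railroads P + 1 := by
  obtain ⟨t, ht, hfree⟩ : ∃ t ∈ L.reserved, P.improvement t ≠ .railroad := by
    by_contra! hall
    rw [railroads, Finset.filter_true_of_mem hall, L.reserved_card] at hlt
    exact hlt.false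
  obtain ⟨m, hm, hmove⟩ := hP.exists_play_move (S := S) ht
  exact ⟨_, Nat.add_le_add hm (S.turns_le .railroad), _,
    hmove.trans (Play.build ⟨hS, by simpa using hfree⟩ hP.2.2),
    L.stateWork_setImprovement P .railroad ht,
    L.railroads_update_railroad (by simp [Position.setImprovement]) ht hfree⟩

theorem StateReady.exists_removeRailroad (hP : L.StateReady P) (hpos : 0 < L.railroads P) :
    ∃ n ≤ L.reservedDiam + 1, ∃ P', Play G S n P P' ∧ L.StateWork P P' ∧
      L.railroads P = L.railroads P' + 1 := by
  obtain ⟨t, ht⟩ := Finset.card_pos.1 hpos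
  obtain ⟨ht, hrail⟩ := Finset.mem_filter.1 ht
  obtain ⟨m, hm, hmove⟩ := hP.exists_play_move (S := S) ht
  refine ⟨_, Nat.add_le_add_right hm 1, _, hmove.trans (Play.remove (by simp [hrail]) hP.2.2),
    L.stateWork_setImprovement P .noImprovement ht, L.railroads_update_railroad ?_ ht ?_⟩
  · simp [Position.setImprovement, ← hrail]
  · simp [Position.setImprovement]

theorem StateReady.exists_buildRailroads (hS : S.engineering) (hP : L.StateReady P) {k : ℕ}
    (hk : L.railroads P + k ≤ 9) :
    ∃ n ≤ k * (L.reservedDiam + max S.roadTurns S.railroadTurns), ∃ P', Play G S n P P' ∧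
      L.StateWork P P' ∧ L.railroads P' = L.railroads P + k := by
  induction k with
  | zero => exact ⟨0, Nat.zero_le _, P, .nil P, hP.stateWork_self, rfl⟩
  | succ k ih =>
    obtain ⟨n, hn, P₁, hplay₁, hwork₁, hrail₁⟩ := ih (by omega)
    obtain ⟨m, hm, P₂, hplay₂, hwork₂, hrail₂⟩ :=
      (hP.of_stateWork hwork₁).exists_buildRailroad hS (by omega)
    refine ⟨n + m, ?_, P₂, hplay₁.trans hplay₂, hwork₁.trans hwork₂, by omega⟩
    rw [Nat.succ_mul]
    exact Nat.add_le_add hn hm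

theorem StateReady.exists_removeRailroads (hP : L.StateReady P) {k : ℕ} (hk : k ≤ L.railroads P) :
    ∃ n ≤ k * (L.reservedDiam + 1), ∃ P', Play G S n P P' ∧ L.StateWork P P' ∧
      L.railroads P = L.railroads P' + k := by
  induction k with
  | zero => exact ⟨0, Nat.zero_le _, P, .nil P, hP.stateWork_self, rfl⟩
  | succ k ih =>
    obtain ⟨n, hn, P₁, hplay₁, hwork₁, hrail₁⟩ := ih (by omega)
    obtain ⟨m, hm, P₂, hplay₂, hwork₂, hrail₂⟩ :=
      (hP.of_stateWork hwork₁).exists_removeRailroad (S := S) (by omega)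
    refine ⟨n + m, ?_, P₂, hplay₁.trans hplay₂, hwork₁.trans hwork₂, by omega⟩
    rw [Nat.succ_mul]
    exact Nat.add_le_add hn hm

theorem StateReady.exists_changeRailroads (hS : S.engineering) (hP : L.StateReady P) {c : ℤ}
    (hc : (L.railroads P : ℤ) + c ∈ Set.Icc 0 9) :
    ∃ n ≤ c.toNat * (L.reservedDiam + max S.roadTurns S.railroadTurns) +
        (-c).toNat * (L.reservedDiam + 1),
      ∃ P', Play G S n P P' ∧ L.StateWork P P' ∧ (L.railroads P' : ℤ) = L.railroads P + c := by
  obtain ⟨hc₀, hc₉⟩ := hc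
  obtain hsign | hsign := le_total 0 c
  · obtain ⟨n, hn, P', hplay, hwork, hrail⟩ :=
      hP.exists_buildRailroads hS (k := c.toNat) (by omega)
    exact ⟨n, hn.trans (Nat.le_add_right ..), P', hplay, hwork, by omega⟩
  · obtain ⟨n, hn, P', hplay, hwork, hrail⟩ :=
      hP.exists_removeRailroads (S := S) (k := (-c).toNat) (by omega)
    exact ⟨n, hn.trans (Nat.le_add_left ..), P', hplay, hwork, by omega⟩

end StateWorker

section Commands

variable {S : Session} {P : Position}

theorem exists_play_tapeWorker {o : TapeOrder} {p : ℤ} (d : Turing.Dir) (hS : S.engineering)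
    (hp : P.worker .tape = L.strip p) (hstate : P.worker .state ∈ L.reserved)
    (h0 : P.progress = 0) (ho : o.Applicable (P.improvement (L.strip p))) :
    ∃ n ≤ 2 + max S.roadTurns S.railroadTurns, Play G S n P
      ⟨Function.update P.improvement (L.strip p) (o.result (P.improvement (L.strip p))), 0,
        Function.update P.worker .tape (L.strip (p + offset d))⟩ := by
  rw [← hp] at ho ⊢
  obtain ⟨n, hn, hplay⟩ := Play.exists_tapeOrder (G := G) hS ho h0
  have hadj := L.strip_adj_add_offset p d
  have hlegal : Legal G S (P.setImprovement .tape (o.result (P.improvement (P.worker .tape))))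
      .tape (.move (L.strip (p + offset d))) := by
    refine ⟨hp ▸ hadj, L.strip_traversable _, fun v hv => ?_⟩
    cases v with
    | tape => exact hadj.ne (hp.symm.trans hv)
    | state => exact L.strip_notMem_reserved _ (hv ▸ hstate)
  exact ⟨n + 1, by omega, hplay.trans (Play.of_legal hlegal)⟩

theorem exists_play_carriesOut {C : TuringMachine.Config (Fin 10) Improvement} {c : Command}
    (hS : S.engineering) (hR : L.Represents C P) (hc : L.command P = some c) :
    ∃ n P', n ≤ 4 * max S.roadTurns S.railroadTurns + 1 + (8 * L.reservedDiam + 6) ∧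
      Play G S n P P' ∧ L.CarriesOut c P P' := by
  obtain ⟨-, ⟨p, hp, -⟩, hstate, h0⟩ := hR
  have ho := applicable_of_commandTable hc
  rw [hp] at ho
  obtain ⟨n, hn, hplay⟩ := L.exists_play_tapeWorker c.dir hS hp hstate h0 ho
  set P₁ : Position := ⟨Function.update P.improvement (L.strip p)
    (c.tape.result (P.improvement (L.strip p))), 0,
    Function.update P.worker .tape (L.strip (p + offset c.dir))⟩
  have htape₁ : P₁.worker .tape = L.strip (p + offset c.dir) := by simp [P₁]
  have hrail₁ : L.railroads P₁ = L.railroads P := L.railroads_congr fun t ht =>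
    Function.update_of_ne (ne_of_mem_of_not_mem ht (L.strip_notMem_reserved p)) ..
  have hready : L.StateReady P₁ :=
    ⟨htape₁ ▸ L.strip_notMem_area _, by simpa [P₁] using hstate, rfl⟩
  have hsum : (L.railroads P₁ : ℤ) + c.change ∈ Set.Icc 0 9 :=
    hrail₁ ▸ add_change_mem_Icc_of_commandTable hc
  obtain ⟨m, hm, P₂, hplay₂, ⟨htape₂, hstate₂, hprogress₂, hrest₂⟩, hrail₂⟩ :=
    hready.exists_changeRailroads hS hsum
  refine ⟨n + m, P₂, ?_, hplay.trans hplay₂, ⟨p, hp, htape₂.trans htape₁, ?_, fun t ht htr => ?_⟩,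
    hrail₁ ▸ hrail₂, hstate₂, hprogress₂⟩
  · obtain ⟨hge, hle⟩ := change_mem_Icc_of_commandTable hc
    have hbuild := Nat.mul_le_mul_right (L.reservedDiam + max S.roadTurns S.railroadTurns)
      (show c.change.toNat ≤ 3 by omega)
    have hremove := Nat.mul_le_mul_right (L.reservedDiam + 1)
      (show (-c.change).toNat ≤ 5 by omega)
    omega
  · rw [hrest₂ _ (L.strip_notMem_reserved p)]
    exact Function.update_self ..
  · rw [hrest₂ t htr]
    exact Function.update_of_ne ht ..

end Commands

end Layout

end CivV

theorem theorem2 :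
    -- ten states and three symbols
    Fintype.card (Fin 10) = 10 ∧ Fintype.card CivV.Improvement = 3 ∧
    -- the machine is universal
    CivV.machine.IsUniversal ∧
    -- its program corresponds one-to-one to Rogozhin's
    Function.Bijective CivV.toRogozhin ∧
    (∀ (q : Fin 10) (s : CivV.Improvement),
      CivV.rogozhinProgram q (CivV.toRogozhin s) =
        (CivV.machine.δ q s).map fun a => (a.1, CivV.toRogozhin a.2.1, a.2.2)) ∧
    -- the game carries the machine, with constant overhead
    ∀ (G : CivV.GameMap) (L : CivV.Layout G),
      (∀ C, ∃ P, L.Represents C P) ∧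
      ∃ K : ℕ, ∀ S : CivV.Session, S.engineering →
        ∀ C P, L.Represents C P →
          (CivV.machine.step C = none ↔ L.command P = none) ∧
          ∀ c, L.command P = some c →
            (∃ n P', n ≤ 4 * max S.roadTurns S.railroadTurns + 1 + K ∧
              CivV.Play G S n P P' ∧ L.CarriesOut c P P') ∧
            ∀ P', L.CarriesOut c P P' →
              ∃ C', CivV.machine.step C = some C' ∧ L.Represents C' P' := by
  refine ⟨rfl, rfl, CivV.machine_isUniversal, CivV.toRogozhin_bijective,
    CivV.rogozhinProgram_toRogozhin, fun G L => ⟨L.exists_represents, 8 * L.reservedDiam + 6,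
      fun S hS C P hR => ⟨hR.step_eq_none_iff, fun c hc => ⟨?_, fun P' hP' => ?_⟩⟩⟩⟩
  · exact L.exists_play_carriesOut hS hR hc
  · exact hR.of_carriesOut hc hP'
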